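/- Let $M\ge 1$, $K\ge 0$ and $l_1,\dots,l_K\ge 0$ be integers, and put $l^*=\sum_k l_k$. For a random vector $U$ in $\mathbb{C}^m$ write $\hbar(U)=h(U+Z)$, where $h$ is differential entropy and $Z\sim\mathcal{CN}(0,I)$ is independent of $U$. For each channel use $t=1,2,\dots$ let $L^{[1]}(t),\dots,L^{[K]}(t)$ be subspaces of $\mathbb{C}^M$ with $\dim L^{[k]}(t)=l_k$; fix bases of them, let $B_k(t)$ be the $M\times l_k$ matrix whose columns are the basis vectors of $L^{[k]}(t)$, and for random vectors $X^n=(X(1),\dots,X(n))$ in $\mathbb{C}^M$ let $L^{[k]^n}\circ X^n=(B_k(1)^TX(1),\dots,B_k(n)^TX(n))$. All subspaces and bases are fixed, independently of the power $\rho$. At each $t$, collect the subspaces into sets as follows. Go through the sequence $L^{[1]}(t),\dots,L^{[K]}(t)$ in order, keeping the span $S$ of the vectors collected in the current set (initially $S=0$). As long as $S\ne\mathbb{C}^M$, split the next subspace $V$ into $S\cap V$ and a complementary part; the complementary part joins the set, so that $S$ becomes $S+V$, and $S\cap V$ is left over (if $S\cap V=0$, then $V$ joins the set as a whole). When $S=\mathbb{C}^M$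 the set is complete; then a new set is started from the sequence that consists of the left-over parts, in order, followed by the subspaces not yet used. The process stops when what is left does not suffice to complete the current set. Let $L_\Sigma$ be an integer such that at every $t$ the process generates at least $L_\Sigma$ complete sets (for instance the number of complete sets, if this is the same for all $t$). (a) For every $n$ there is a function $f$ with $f(\rho)=o(\log\rho)$ as $\rho\to\infty$ such that for all $\rho>0$ and all random $X^n$ with $\frac1n\sum_{t=1}^n\mathbb{E}\|X(t)\|^2\le\rho$, $$\sum_{k=1}^K\hbar\big(L^{[k]^n}\circ X^n\big)\;\ge\;L_\Sigma\,\hbar(X^n)+n\,f(\rho).$$ If the matrices $B_k(t)$ take only finitely many values as $t$ varies (for instance, if they are constant in time), then $f$ can be chosen independently of $n$. (b) If $l_k\le M$ for all $k$, then for Lebesgue-almost every choice of the $l^*$ vectors in $\mathbb{C}^M$ that span the $K$ subspaces, these vectors are bases of the subspaces and the number of complete sets is exactly $\lfloor l^*/M\rfloor$. -/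

import Mathlib

open MeasureTheory Filter Asymptotics
open scoped ENNReal

/-! ### Differential entropy and its noisy version -/

section Entropy

/-- The circularly symmetric complex Gaussian law `CN(0, I)` on `ℂ^ι`, given by its density
`π^(-|ι|) exp(-∑ |z_i|²)` with respect to Lebesgue measure. -/
noncomputable def stdComplexGaussian (ι : Type*) [Fintype ι] : Measure (ι → ℂ) :=
  volume.withDensity fun z =>
    ENNReal.ofReal ((Real.pi ^ Fintype.card ι)⁻¹ * Real.exp (-∑ i, ‖z i‖ ^ 2))

/-- The differential entropy `h = -∫ p log p` (natural logarithm) of a law on `ℂ^ι`, where `p` is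
its density with respect to Lebesgue measure. -/
noncomputable def diffEntropy {ι : Type*} [Fintype ι] (μ : Measure (ι → ℂ)) : ℝ :=
  ∫ z, Real.negMulLog (μ.rnDeriv volume z).toReal

/-- The noisy differential entropy `ħ(U) = h(U + Z)` of a complex random vector `U`, where
`Z ∼ CN(0, I)` is independent of `U`: the law of `U + Z` is the convolution of the two laws. -/
noncomputable def hbar {Ω : Type*} [MeasurableSpace Ω] (P : Measure Ω)
    {ι : Type*} [Fintype ι] (U : Ω → ι → ℂ) : ℝ :=
  diffEntropy (Measure.conv (P.map U) (stdComplexGaussian ι))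

/-- The vectors `X(t)`, `t < n`, put together into one random vector `X^n`. -/
def stack {Ω : Type*} {n M : ℕ} (X : Fin n → Ω → Fin M → ℂ) : Ω → Fin n × Fin M → ℂ :=
  fun ω p => X p.1 ω p.2

/-- `B(L(t))ᵀ X(t)`, `t < n`, put together into one random vector: here `b t 0, …, b t (m-1)` are
the columns of the basis representation `B(L(t))` of the subspace `L(t)`. -/
def projStack {Ω : Type*} {n M m : ℕ} (b : Fin n → Fin m → Fin M → ℂ)
    (X : Fin n → Ω → Fin M → ℂ) : Ω → Fin n × Fin m → ℂ :=
  fun ω p => ∑ i, b p.1 p.2 i * X p.1 ω i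

end Entropy

/-! ### Collecting subspaces into complete sets -/

section Collecting

variable {E : Type*} [AddCommGroup E] [Module ℂ E]

open Classical in
/-- Filling one set. `S` is the span of the vectors collected in the set so far and the list is the
sequence of subspaces still to be used. As soon as `S` is the whole space the set is complete and
the rest of the sequence is left over. Otherwise the next subspace `V` is split into its
intersection `S ⊓ V` with the span of the set and a complementary part; the latter is incorporated
into the set, whose span becomes `S ⊔ V`, and the intersection is put back, at its place in the
sequence, for the following sets (if `S ⊓ V = ⊥` then `V` is incorporated as a whole).
The result is the span of the set and the left-over sequence. -/
noncomputable def fillSet : Submodule ℂ E → List (Submodule ℂ E) →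
    Submodule ℂ E × List (Submodule ℂ E)
  | S, [] => (S, [])
  | S, V :: Q =>
    if S = ⊤ then (S, V :: Q)
    else ((fillSet (S ⊔ V) Q).1, (S ⊓ V) :: (fillSet (S ⊔ V) Q).2)

/-- The sequence of subspaces that is left over after `j` sets have been filled. -/
noncomputable def leftover (Q : List (Submodule ℂ E)) : ℕ → List (Submodule ℂ E)
  | 0 => Q
  | j + 1 => (fillSet ⊥ (leftover Q j)).2

/-- The number of complete sets that the process generates from the sequence `Q`: it stops at the
first set that the left-over subspaces do not suffice to complete. -/
noncomputable def numCompleteSets (Q : List (Submodule ℂ E)) : ℕ :=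
  sInf {j | (fillSet ⊥ (leftover Q j)).1 ≠ ⊤}

end Collecting

/-- The sequence `L^{[1]}, …, L^{[K]}` of subspaces of `ℂ^M` spanned by `K` families of vectors. -/
def spans {M K : ℕ} {l : Fin K → ℕ} (b : ∀ k, Fin (l k) → Fin M → ℂ) :
    List (Submodule ℂ (Fin M → ℂ)) :=
  List.ofFn fun k => Submodule.span ℂ (Set.range (b k))

universe u

/-- The noisy entropy bound at block length `n`, with remainder `n f(ρ)`: for every power `ρ > 0`
and all random vectors `X(t)`, `t < n`, with average power at most `ρ`,
`∑_k ħ(L^{[k]^n} ∘ X^n) ≥ Lsum · ħ(X^n) + n f(ρ)`, where `b t k` is the basis of `L^{[k]}(t)`. -/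
def NoisyEntropyBound {M K : ℕ} {l : Fin K → ℕ} (b : ℕ → ∀ k, Fin (l k) → Fin M → ℂ)
    (Lsum n : ℕ) (f : ℝ → ℝ) : Prop :=
  ∀ (ρ : ℝ), 0 < ρ →
  ∀ (Ω : Type u) [MeasurableSpace Ω] (P : Measure Ω) [IsProbabilityMeasure P]
    (X : Fin n → Ω → Fin M → ℂ), (∀ t, Measurable (X t)) →
    (∑ t, ∫⁻ ω, ∑ i, ‖X t ω i‖ₑ ^ 2 ∂P) ≤ n * ENNReal.ofReal ρ →
    ∑ k, hbar P (projStack (fun t : Fin n => b t k) X) ≥ Lsum * hbar P (stack X) + n * f ρ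

/-! Up to bounded errors, the noisy entropy of a projection to S is a submodular function of S. For
a block S = (S t) of subspaces let q_S be the sum over t of the squared norms of the projections to
S t (`blockForm`). Put m_S(y) = E exp(-q_S(y - X')) with X' an independent copy of X, and g(S) = -E
log m_S(X + Z), which is `-meanLogMix`. The noise Z is full-dimensional for every S, so all these
quantities are expectations over one law. Then g(⊥) = 0, g ≥ 0, g(⊤) = ħ(X^n) - nM log π, and
g(L^[k]) ≤ ħ(B_kᵀ X) + O(n) (`neg_meanLogMix_le_diffEntropy_map`).

Submodularity, g(S ⊔ V) + g(S ⊓ V) ≤ g(S) + g(V) + O(n), follows from Jensen once E[m_S m_V /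
(m_{S⊔V} m_{S⊓V})] is bounded at X + Z. The density of X + Z is a multiple of m_⊤. In linear
coordinates adapted to S and V (`nonempty_splitCoords`), integrating m_⊤ over the directions
orthogonal to S ⊔ V cancels m_{S⊔V}; integrating m_S over those of S outside S ⊓ V cancels m_{S⊓V};
what remains is the total mass of m_V. The only loss is the Jacobian, which depends on the subspaces
alone (`meanLogMix_submodular`).

Each step of the collecting process replaces S, V by S ⊔ V, S ⊓ V, so it raises the total of g by
O(n) at most. After L rounds there are L copies of ⊤ and a nonnegative rest (`sum_mergeLeft_le`).
Every error is n times a constant determined by the bases, free of ρ; finitely many bases give a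
constant free of n.

For generic subspaces the left-over parts vanish except when a set is completed, where S ⊓ V has
dimension dim S + dim V - M and opens the next set. Hence each complete set uses exactly M
dimensions (`GeneralPosition.completesExactly`). General position holds almost everywhere by Fubini,
one subspace at a time (`ae_generalPosition`). -/

/-! ### Gaussian mixtures and their logarithms -/

section GaussianMixtures

/-- The squared Euclidean norm on `ℂ^ι`. -/
noncomputable def sqNorm {ι : Type*} [Fintype ι] (z : ι → ℂ) : ℝ := ∑ i, ‖z i‖ ^ 2

/-- The mixture `∫ exp (-Q (y - x)) dμ(x)`: up to normalization, the density at `y` of the sum of a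
random vector with law `μ` and an independent noise whose log-density is `-Q`. -/
noncomputable def mixture {V : Type*} [MeasurableSpace V] [Sub V] (μ : Measure V) (Q : V → ℝ)
    (y : V) : ℝ≥0∞ :=
  ∫⁻ x, ENNReal.ofReal (Real.exp (-Q (y - x))) ∂μ

/-- The logarithm of `mixture μ Q`. -/
noncomputable def logMix {V : Type*} [MeasurableSpace V] [Sub V] (μ : Measure V) (Q : V → ℝ)
    (y : V) : ℝ :=
  Real.log (mixture μ Q y).toReal

variable {ι : Type*} [Fintype ι]

lemma sqNorm_nonneg (z : ι → ℂ) : 0 ≤ sqNorm z := Finset.sum_nonneg fun _ _ => by positivity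

lemma measurable_sqNorm : Measurable (sqNorm : (ι → ℂ) → ℝ) := by
  unfold sqNorm; fun_prop

lemma norm_add_sq_le {E : Type*} [SeminormedAddCommGroup E] (a b : E) :
    ‖a + b‖ ^ 2 ≤ 2 * ‖a‖ ^ 2 + 2 * ‖b‖ ^ 2 := by
  have := norm_add_le a b
  nlinarith [norm_nonneg (a + b), sq_nonneg (‖a‖ - ‖b‖), norm_nonneg a, norm_nonneg b]

lemma sqNorm_add_le (a b : ι → ℂ) : sqNorm (a + b) ≤ 2 * sqNorm a + 2 * sqNorm b := by
  unfold sqNorm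
  rw [Finset.mul_sum, Finset.mul_sum, ← Finset.sum_add_distrib]
  exact Finset.sum_le_sum fun i _ => norm_add_sq_le _ _

lemma sqNorm_neg (a : ι → ℂ) : sqNorm (-a) = sqNorm a := by simp [sqNorm]

lemma sqNorm_sub_le (a b : ι → ℂ) : sqNorm (a - b) ≤ 2 * sqNorm a + 2 * sqNorm b := by
  rw [sub_eq_add_neg, ← sqNorm_neg b]; exact sqNorm_add_le _ _

lemma integral_exp_neg_mul_sq_complex {c : ℝ} (hc : 0 < c) (w : ℂ) :
    ∫ z : ℂ, Real.exp (-c * ‖z - w‖ ^ 2) = Real.pi / c := by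
  rw [integral_sub_right_eq_self (fun z : ℂ => Real.exp (-c * ‖z‖ ^ 2)) w,
    GaussianFourier.integral_rexp_neg_mul_sq_norm hc]
  simp [Complex.finrank_real_complex]

lemma integrable_exp_neg_mul_sq_complex {c : ℝ} (hc : 0 < c) (w : ℂ) :
    Integrable (fun z : ℂ => Real.exp (-c * ‖z - w‖ ^ 2)) := by
  by_contra hni
  have h := integral_exp_neg_mul_sq_complex hc w
  -- A non-integrable function has integral 0 by convention, which contradicts the positive value.
  rw [integral_undef hni] at h
  have : 0 < Real.pi / c := by positivity
  linarith

lemma exp_neg_mul_sqNorm (c : ℝ) (z : ι → ℂ) :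
    Real.exp (-c * sqNorm z) = ∏ i, Real.exp (-c * ‖z i‖ ^ 2) := by
  rw [sqNorm, Finset.mul_sum, Real.exp_sum]

lemma lintegral_exp_neg_mul_sqNorm {c : ℝ} (hc : 0 < c) (w : ι → ℂ) :
    ∫⁻ z : ι → ℂ, ENNReal.ofReal (Real.exp (-c * sqNorm (z - w))) =
      ENNReal.ofReal (Real.pi / c) ^ Fintype.card ι := by
  rw [← ofReal_integral_eq_lintegral_ofReal _ (ae_of_all _ fun _ => (Real.exp_pos _).le)]
  · simp only [exp_neg_mul_sqNorm, Pi.sub_apply]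
    rw [integral_fintype_prod_volume_eq_prod fun i (z : ℂ) => Real.exp (-c * ‖z - w i‖ ^ 2)]
    simp only [integral_exp_neg_mul_sq_complex hc, Finset.prod_const, Finset.card_univ]
    rw [ENNReal.ofReal_pow (by positivity)]
  · simp only [exp_neg_mul_sqNorm, Pi.sub_apply]
    exact Integrable.fintype_prod (f := fun i (z : ℂ) => Real.exp (-c * ‖z - w i‖ ^ 2))
      fun i => integrable_exp_neg_mul_sq_complex hc _

section Mixture

variable {μ : Measure (ι → ℂ)} [IsProbabilityMeasure μ] {Q : (ι → ℂ) → ℝ}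

lemma measurable_mixture (hQ : Measurable Q) : Measurable (mixture μ Q) := by
  unfold mixture
  apply Measurable.lintegral_prod_right
  fun_prop

lemma measurable_logMix (hQ : Measurable Q) : Measurable (logMix μ Q) :=
  Real.measurable_log.comp (measurable_mixture hQ).ennreal_toReal

omit [Fintype ι] in
lemma mixture_le_one (hQ0 : ∀ z, 0 ≤ Q z) (y : ι → ℂ) : mixture μ Q y ≤ 1 := by
  refine (lintegral_mono (g := fun _ => 1) fun x => ?_).trans (by simp)
  simpa using hQ0 (y - x)

omit [Fintype ι] in
lemma mixture_ne_top (hQ0 : ∀ z, 0 ≤ Q z) (y : ι → ℂ) : mixture μ Q y ≠ ∞ :=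
  ((mixture_le_one hQ0 y).trans_lt ENNReal.one_lt_top).ne

omit [Fintype ι] in
lemma mixture_pos (hQ : Measurable Q) (y : ι → ℂ) : 0 < mixture μ Q y := by
  unfold mixture
  rw [lintegral_pos_iff_support (by fun_prop)]
  have : Function.support (fun x => ENNReal.ofReal (Real.exp (-Q (y - x)))) = Set.univ := by
    ext x; simp [Real.exp_pos]
  rw [this]; simp

omit [Fintype ι] in
lemma logMix_nonpos (hQ0 : ∀ z, 0 ≤ Q z) (y : ι → ℂ) : logMix μ Q y ≤ 0 :=
  Real.log_nonpos ENNReal.toReal_nonneg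
    (by simpa using ENNReal.toReal_mono ENNReal.one_ne_top (mixture_le_one (μ := μ) hQ0 y))

/-- Jensen's inequality for the exponential, in the form of a lower bound on `logMix`. -/
lemma neg_le_logMix (hQ : Measurable Q) (hQ0 : ∀ z, 0 ≤ Q z) {c : ℝ} (hc : 0 ≤ c)
    (hQc : ∀ z, Q z ≤ c * sqNorm z) (hμ : Integrable sqNorm μ) (y : ι → ℂ) :
    -(2 * c * (sqNorm y + ∫ x, sqNorm x ∂μ)) ≤ logMix μ Q y := by
  -- m bounds the mean of Q (y - x). The tangent line of exp(-·) at m is a lower bound for exp(-Q)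
  -- and averages to at least exp(-m).
  set m := 2 * c * (sqNorm y + ∫ x, sqNorm x ∂μ) with hm
  have hint : Integrable (fun x => Real.exp (-m) * ((1 + m - 2 * c * sqNorm y) - 2 * c * sqNorm x)) μ := by
    exact ((integrable_const _).sub (hμ.const_mul _)).const_mul _
  have hval : ∫ x, Real.exp (-m) * ((1 + m - 2 * c * sqNorm y) - 2 * c * sqNorm x) ∂μ =
      Real.exp (-m) := by
    rw [integral_const_mul, integral_sub (integrable_const _) (hμ.const_mul _), integral_const_mul]
    simp only [integral_const, probReal_univ, smul_eq_mul, one_mul]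
    have : 1 + m - 2 * c * sqNorm y - 2 * c * ∫ x, sqNorm x ∂μ = 1 := by rw [hm]; ring
    rw [this, mul_one]
  have hexp : Integrable (fun x => Real.exp (-Q (y - x))) μ := by
    refine Integrable.mono' (integrable_const (1 : ℝ))
      (Measurable.aestronglyMeasurable (by fun_prop)) (ae_of_all _ fun x => ?_)
    rw [Real.norm_of_nonneg (Real.exp_pos _).le, Real.exp_le_one_iff]
    linarith [hQ0 (y - x)]
  have hle : ENNReal.ofReal (Real.exp (-m)) ≤ mixture μ Q y := by
    rw [← hval]
    refine (ENNReal.ofReal_le_ofReal (integral_mono hint hexp ?_)).trans ?_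
    · intro x
      have h1 : Q (y - x) ≤ 2 * c * sqNorm y + 2 * c * sqNorm x := by
        have := mul_le_mul_of_nonneg_left (sqNorm_sub_le y x) hc
        linarith [hQc (y - x)]
      have h2 := Real.add_one_le_exp (m - Q (y - x))
      calc _ ≤ Real.exp (-m) * Real.exp (m - Q (y - x)) := by
            apply mul_le_mul_of_nonneg_left _ (Real.exp_pos _).le; linarith
        _ = _ := by rw [← Real.exp_add]; ring_nf
    · rw [ofReal_integral_eq_lintegral_ofReal hexp (ae_of_all _ fun _ => (Real.exp_pos _).le)]
      exact le_rfl
  unfold logMix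
  rw [Real.le_log_iff_exp_le (ENNReal.toReal_pos (mixture_pos hQ y).ne' (mixture_ne_top hQ0 y))]
  rwa [← ENNReal.ofReal_le_iff_le_toReal (mixture_ne_top hQ0 y)]

lemma abs_logMix_le (hQ : Measurable Q) (hQ0 : ∀ z, 0 ≤ Q z) {c : ℝ} (hc : 0 ≤ c)
    (hQc : ∀ z, Q z ≤ c * sqNorm z) (hμ : Integrable sqNorm μ) (y : ι → ℂ) :
    ‖logMix μ Q y‖ ≤ 2 * c * (sqNorm y + ∫ x, sqNorm x ∂μ) := by
  rw [Real.norm_of_nonpos (logMix_nonpos hQ0 y)]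
  linarith [neg_le_logMix hQ hQ0 hc hQc hμ y]

/-- `logMix` grows at most quadratically, so it is integrable along random vectors with finite
second moments. -/
lemma integrable_logMix_comp (hQ : Measurable Q) (hQ0 : ∀ z, 0 ≤ Q z) {c : ℝ} (hc : 0 ≤ c)
    (hQc : ∀ z, Q z ≤ c * sqNorm z) (hμ : Integrable sqNorm μ) {Ω : Type*} [MeasurableSpace Ω]
    {P : Measure Ω} [IsFiniteMeasure P] {Y : Ω → ι → ℂ} (hY : Measurable Y)
    (hY2 : Integrable (fun ω => sqNorm (Y ω)) P) :
    Integrable (fun ω => logMix μ Q (Y ω)) P := by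
  refine Integrable.mono' ((hY2.add (integrable_const (∫ x, sqNorm x ∂μ))).const_mul (2 * c))
    ((measurable_logMix hQ).comp hY).aestronglyMeasurable (ae_of_all _ fun ω => ?_)
  exact abs_logMix_le hQ hQ0 hc hQc hμ _

omit [Fintype ι] in
lemma logMix_le_logMix {κ : Type*} {ν : Measure (κ → ℂ)} [IsProbabilityMeasure ν]
    {R : (κ → ℂ) → ℝ} (hQ : Measurable Q) (hR0 : ∀ z, 0 ≤ R z) {y : ι → ℂ} {u : κ → ℂ}
    (h : mixture μ Q y ≤ mixture ν R u) :
    logMix μ Q y ≤ logMix ν R u := by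
  have hne : mixture μ Q y ≠ ∞ := (h.trans_lt (mixture_ne_top hR0 u).lt_top).ne
  exact Real.log_le_log (ENNReal.toReal_pos (mixture_pos hQ y).ne' hne)
    (ENNReal.toReal_mono (mixture_ne_top hR0 u) h)

end Mixture

/-- Jensen's inequality for the logarithm. -/
lemma integral_log_toReal_le {Ω : Type*} [MeasurableSpace Ω] {P : Measure Ω}
    [IsProbabilityMeasure P] {f : Ω → ℝ≥0∞} (hf : Measurable f) (hf0 : ∀ ω, 0 < (f ω).toReal)
    (hlog : Integrable (fun ω => Real.log (f ω).toReal) P) {C : ℝ} (hC : 0 < C)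
    (h : ∫⁻ ω, f ω ∂P ≤ ENNReal.ofReal C) :
    ∫ ω, Real.log (f ω).toReal ∂P ≤ Real.log C := by
  have hfin : ∫⁻ ω, f ω ∂P ≠ ∞ := (h.trans_lt ENNReal.ofReal_lt_top).ne
  have hi : Integrable (fun ω => (f ω).toReal) P :=
    integrable_toReal_of_lintegral_ne_top hf.aemeasurable hfin
  have hle : ∫ ω, (f ω).toReal ∂P ≤ C := by
    rw [integral_toReal hf.aemeasurable (ae_lt_top hf hfin)]
    exact ENNReal.toReal_le_of_le_ofReal hC.le h
  calc ∫ ω, Real.log (f ω).toReal ∂P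
      ≤ ∫ ω, ((f ω).toReal / C + (Real.log C - 1)) ∂P := by
        refine integral_mono hlog ((hi.div_const C).add (integrable_const _)) fun ω => ?_
        have := Real.log_le_sub_one_of_pos (div_pos (hf0 ω) hC)
        rw [Real.log_div (hf0 ω).ne' hC.ne'] at this
        simp only; linarith
    _ = (∫ ω, (f ω).toReal ∂P) / C + (Real.log C - 1) := by
        rw [integral_add (hi.div_const C) (integrable_const _), integral_div]; simp
    _ ≤ Real.log C := by
        have : (∫ ω, (f ω).toReal ∂P) / C ≤ 1 := (div_le_one hC).2 hle
        linarith

/-! ### The Gaussian noise and the density of the noisy vector -/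

section Noise

lemma stdComplexGaussian_eq : stdComplexGaussian ι = (volume : Measure (ι → ℂ)).withDensity
    fun z => ENNReal.ofReal (Real.pi ^ Fintype.card ι)⁻¹ * ENNReal.ofReal (Real.exp (-sqNorm z)) := by
  unfold stdComplexGaussian
  congr 1; ext z
  rw [ENNReal.ofReal_mul (by positivity)]; rfl

instance : IsProbabilityMeasure (stdComplexGaussian ι) := by
  refine ⟨?_⟩
  rw [stdComplexGaussian_eq, withDensity_apply _ MeasurableSet.univ, Measure.restrict_univ,
    lintegral_const_mul _ (by have := measurable_sqNorm (ι := ι); fun_prop)]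
  have := lintegral_exp_neg_mul_sqNorm (ι := ι) one_pos 0
  simp only [neg_mul, one_mul, sub_zero, div_one] at this
  rw [this, ← ENNReal.ofReal_pow Real.pi_pos.le, ← ENNReal.ofReal_mul (by positivity),
    inv_mul_cancel₀ (by positivity), ENNReal.ofReal_one]

/-- The law of `X + Z` has density `π^(-|ι|) mixture μ sqNorm`. -/
lemma conv_stdComplexGaussian (μ : Measure (ι → ℂ)) [IsProbabilityMeasure μ] :
    μ.conv (stdComplexGaussian ι) = (volume : Measure (ι → ℂ)).withDensity
      fun y => ENNReal.ofReal (Real.pi ^ Fintype.card ι)⁻¹ * mixture μ sqNorm y := by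
  have hm := measurable_sqNorm (ι := ι)
  have hmix := measurable_mixture (μ := μ) hm
  refine Measure.ext_of_lintegral _ fun f hf => ?_
  rw [Measure.lintegral_conv hf, stdComplexGaussian_eq]
  rw [lintegral_withDensity_eq_lintegral_mul _ (by fun_prop) hf]
  simp only [Pi.mul_apply]
  have : ∀ x : ι → ℂ, ∫⁻ y, f (x + y) ∂(volume.withDensity fun z =>
      ENNReal.ofReal (Real.pi ^ Fintype.card ι)⁻¹ * ENNReal.ofReal (Real.exp (-sqNorm z))) =
      ∫⁻ y, ENNReal.ofReal (Real.pi ^ Fintype.card ι)⁻¹ *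
        ENNReal.ofReal (Real.exp (-sqNorm (y - x))) * f y := by
    intro x
    rw [lintegral_withDensity_eq_lintegral_mul _ (by fun_prop) (by fun_prop)]
    rw [← lintegral_sub_right_eq_self _ x]
    simp
  simp_rw [this]
  rw [lintegral_lintegral_swap (by fun_prop)]
  refine lintegral_congr fun y => ?_
  rw [lintegral_mul_const _ (by fun_prop), lintegral_const_mul _ (by fun_prop)]
  rfl

/-- Since s ≤ 2 exp(s/2), the integrand is dominated by a Gaussian with half the rate. -/
lemma lintegral_sqNorm_mul_exp_lt_top :
    ∫⁻ z : ι → ℂ, ENNReal.ofReal (sqNorm z) ∂(stdComplexGaussian ι) < ∞ := by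
  have hm := measurable_sqNorm (ι := ι)
  rw [stdComplexGaussian_eq, lintegral_withDensity_eq_lintegral_mul _ (by fun_prop) (by fun_prop)]
  calc _ ≤ ∫⁻ z : ι → ℂ, ENNReal.ofReal (Real.pi ^ Fintype.card ι)⁻¹ * (ENNReal.ofReal 2 *
        ENNReal.ofReal (Real.exp (-(1/2) * sqNorm (z - 0)))) := by
        refine lintegral_mono fun z => ?_
        simp only [Pi.mul_apply]
        rw [mul_assoc, ← ENNReal.ofReal_mul (Real.exp_pos _).le,
          ← ENNReal.ofReal_mul (zero_le_two : (0 : ℝ) ≤ 2)]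
        refine mul_le_mul_right (ENNReal.ofReal_le_ofReal ?_) _
        have h := Real.add_one_le_exp (1/2 * sqNorm z)
        have h2 : Real.exp (-(1/2) * sqNorm (z - 0)) =
            Real.exp (-sqNorm z) * Real.exp (1/2 * sqNorm z) := by
          rw [← Real.exp_add, sub_zero]; ring_nf
        rw [h2]
        have h3 := Real.exp_pos (-sqNorm z)
        nlinarith
    _ < ∞ := by
        rw [lintegral_const_mul _ (by fun_prop), lintegral_const_mul _ (by fun_prop),
          lintegral_exp_neg_mul_sqNorm (by norm_num)]
        exact ENNReal.mul_lt_top ENNReal.ofReal_lt_top (ENNReal.mul_lt_top ENNReal.ofReal_lt_top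
          (ENNReal.pow_lt_top ENNReal.ofReal_lt_top))

lemma integrable_sqNorm_stdComplexGaussian :
    Integrable sqNorm (stdComplexGaussian ι) := by
  refine ⟨measurable_sqNorm.aestronglyMeasurable, ?_⟩
  rw [hasFiniteIntegral_iff_ofReal (ae_of_all _ sqNorm_nonneg)]
  exact lintegral_sqNorm_mul_exp_lt_top

end Noise

end GaussianMixtures

/-! ### Mean log-mixtures, and their stability under change of noise -/

section MeanLogMixture

variable {ι : Type*} [Fintype ι]

/-- A nonnegative measurable function bounded by a multiple of the squared norm. -/
structure QuadBound (Q : (ι → ℂ) → ℝ) (c : ℝ) : Prop where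
  measurable : Measurable Q
  nonneg : ∀ z, 0 ≤ Q z
  const_nonneg : 0 ≤ c
  le : ∀ z, Q z ≤ c * sqNorm z

lemma quadBound_mul_sqNorm {c : ℝ} (hc : 0 ≤ c) :
    QuadBound (fun z : ι → ℂ => c * sqNorm z) c :=
  ⟨measurable_sqNorm.const_mul c, fun z => mul_nonneg hc (sqNorm_nonneg z), hc, fun _ => le_rfl⟩

lemma quadBound_sqNorm : QuadBound (sqNorm : (ι → ℂ) → ℝ) 1 :=
  ⟨measurable_sqNorm, sqNorm_nonneg, zero_le_one, fun z => (one_mul (sqNorm z)).ge⟩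

variable {μ : Measure (ι → ℂ)} [IsProbabilityMeasure μ]

lemma integrable_sqNorm_add (hμ : Integrable sqNorm μ) (a : ι → ℂ) :
    Integrable (fun u => sqNorm (u + a)) μ := by
  refine Integrable.mono' ((hμ.const_mul 2).add (integrable_const (2 * sqNorm a)))
    (measurable_sqNorm.comp (measurable_id.add_const a)).aestronglyMeasurable
    (ae_of_all _ fun u => ?_)
  rw [Real.norm_of_nonneg (sqNorm_nonneg _)]
  exact sqNorm_add_le _ _

lemma integrable_sqNorm_conv {ν : Measure (ι → ℂ)} [IsProbabilityMeasure ν]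
    (hμ : Integrable sqNorm μ) (hν : Integrable sqNorm ν) : Integrable sqNorm (μ.conv ν) := by
  unfold Measure.conv
  rw [integrable_map_measure measurable_sqNorm.aestronglyMeasurable (by fun_prop)]
  refine Integrable.mono' (((hμ.comp_fst ν).const_mul 2).add ((hν.comp_snd μ).const_mul 2))
    (measurable_sqNorm.comp (by fun_prop)).aestronglyMeasurable (ae_of_all _ fun p => ?_)
  rw [Function.comp_apply, Real.norm_of_nonneg (sqNorm_nonneg _)]
  exact sqNorm_add_le _ _

lemma QuadBound.integrable_logMix {Q : (ι → ℂ) → ℝ} {c : ℝ} (hQ : QuadBound Q c)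
    (hμ : Integrable sqNorm μ) {ν : Measure (ι → ℂ)} [IsProbabilityMeasure ν]
    (hν : Integrable sqNorm ν) : Integrable (logMix μ Q) ν :=
  integrable_logMix_comp hQ.measurable hQ.nonneg hQ.const_nonneg hQ.le hμ measurable_id hν

/-- The expectation `E log (mixture μ Q (X + Z))`, where `X ∼ μ` and `Z ∼ CN(0, I)` are
independent. -/
noncomputable def meanLogMix (μ : Measure (ι → ℂ)) (Q : (ι → ℂ) → ℝ) : ℝ :=
  ∫ y, logMix μ Q y ∂(μ.conv (stdComplexGaussian ι))

lemma meanLogMix_nonpos {Q : (ι → ℂ) → ℝ} {c : ℝ} (hQ : QuadBound Q c) : meanLogMix μ Q ≤ 0 :=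
  integral_nonpos fun y => logMix_nonpos hQ.nonneg y

/-- The logarithm of the density splits into the normalizing constant and `logMix`, both integrable
under the law of X + Z because of the second moment. -/
lemma diffEntropy_conv_eq (hμ : Integrable sqNorm μ) :
    diffEntropy (μ.conv (stdComplexGaussian ι)) =
      Fintype.card ι * Real.log Real.pi - meanLogMix μ sqNorm := by
  have hm := measurable_sqNorm (ι := ι)
  have hmix := measurable_mixture (μ := μ) hm
  set f : (ι → ℂ) → ℝ≥0∞ := fun y =>
    ENNReal.ofReal (Real.pi ^ Fintype.card ι)⁻¹ * mixture μ sqNorm y with hf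
  have hfm : Measurable f := by fun_prop
  have hlog : ∀ y, Real.log (f y).toReal =
      -(Fintype.card ι * Real.log Real.pi) + logMix μ sqNorm y := by
    intro y
    rw [hf, ENNReal.toReal_mul, ENNReal.toReal_ofReal (by positivity), Real.log_mul (by positivity)
      (ENNReal.toReal_pos (mixture_pos hm y).ne' (mixture_ne_top sqNorm_nonneg y)).ne',
      Real.log_inv, Real.log_pow]
    rfl
  have hint := quadBound_sqNorm.integrable_logMix hμ
    (integrable_sqNorm_conv hμ (integrable_sqNorm_stdComplexGaussian (ι := ι)))
  have h1 : diffEntropy (μ.conv (stdComplexGaussian ι)) =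
      -∫ y, (f y).toReal • Real.log (f y).toReal := by
    unfold diffEntropy
    rw [conv_stdComplexGaussian, ← integral_neg]
    refine integral_congr_ae ?_
    filter_upwards [Measure.rnDeriv_withDensity volume hfm] with y hy
    rw [hy, Real.negMulLog, smul_eq_mul, neg_mul]
  rw [h1, ← integral_withDensity_eq_integral_toReal_smul hfm (ae_of_all _ fun y => ?_),
    ← conv_stdComplexGaussian]
  · simp_rw [hlog]
    rw [integral_add (integrable_const _) hint]
    simp [meanLogMix]
    ring
  · exact ENNReal.mul_lt_top ENNReal.ofReal_lt_top (mixture_ne_top sqNorm_nonneg y).lt_top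

section Comparison

omit [Fintype ι] [IsProbabilityMeasure μ] in
lemma mixture_le_mul_mixture {Q R : (ι → ℂ) → ℝ} (hR : Measurable R) {y y' : ι → ℂ} {k : ℝ}
    (h : ∀ x, R (y' - x) ≤ Q (y - x) + k) :
    mixture μ Q y ≤ ENNReal.ofReal (Real.exp k) * mixture μ R y' := by
  unfold mixture
  rw [← lintegral_const_mul _ (by fun_prop)]
  refine lintegral_mono fun x => ?_
  rw [← ENNReal.ofReal_mul (Real.exp_pos _).le, ← Real.exp_add]
  exact ENNReal.ofReal_le_ofReal (Real.exp_le_exp.2 (by linarith [h x]))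

/-- By Tonelli, integrating in y first removes the dependence on μ. -/
lemma lintegral_mixture_mul_sqNorm {c : ℝ} (hc : 0 < c) :
    ∫⁻ y, mixture μ (fun z => c * sqNorm z) y = ENNReal.ofReal (Real.pi / c) ^ Fintype.card ι := by
  have hm := measurable_sqNorm (ι := ι)
  unfold mixture
  rw [lintegral_lintegral_swap (by fun_prop)]
  simp_rw [← neg_mul, lintegral_exp_neg_mul_sqNorm hc]
  simp

/-- The evaluation point is moved from u + a and u + b to a common u + v, at the price of halving
the rate in the numerator and doubling it in the denominator. Averaging over v with a Gaussian
weight and putting y = u + v, the integral over u reproduces the denominator m2 (y), which cancels,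
and only the total mass of m1 is left. -/
lemma lintegral_mixture_ratio_le {β : ℝ} (hβ : 0 < β) (a b : ι → ℂ) :
    ∫⁻ u, mixture μ sqNorm (u + a) / mixture μ (fun z => β * sqNorm z) (u + b) ∂μ ≤
      ENNReal.ofReal (Real.exp (2 * sqNorm a + 4 * β * sqNorm b) *
        (2 * (2 + 6 * β)) ^ Fintype.card ι) := by
  have hm := measurable_sqNorm (ι := ι)
  set N := Fintype.card ι
  set K := 2 * sqNorm a + 4 * β * sqNorm b with hK
  set r : (ι → ℂ) → ℝ≥0∞ :=
    fun u => mixture μ sqNorm (u + a) / mixture μ (fun z => β * sqNorm z) (u + b) with hr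
  set m1 := mixture μ (fun z => (1 / 2) * sqNorm z) with hm1
  set m2 := mixture μ (fun z => (2 * β) * sqNorm z) with hm2
  have hm1m : Measurable m1 := measurable_mixture (by fun_prop)
  have hm2m : Measurable m2 := measurable_mixture (by fun_prop)
  have hrm : Measurable r := by
    have h1 : Measurable (mixture μ sqNorm) := measurable_mixture hm
    have h2 : Measurable (mixture μ (fun z => β * sqNorm z)) := measurable_mixture (by fun_prop)
    fun_prop
  have hm2pos : ∀ y, m2 y ≠ 0 := fun y => (mixture_pos (by fun_prop) y).ne'
  have hm2top : ∀ y, m2 y ≠ ∞ := fun y =>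
    mixture_ne_top (fun z => mul_nonneg (by positivity) (sqNorm_nonneg z)) y
  -- The rate 2 + 6β is made of 2 to absorb ‖v - a‖², 4β to absorb 2β‖v - b‖², and 2β kept as the
  -- kernel of m2.
  have hpt : ∀ u v : ι → ℂ, r u * ENNReal.ofReal (Real.exp (-(2 + 6 * β) * sqNorm v)) ≤
      ENNReal.ofReal (Real.exp K) *
        (ENNReal.ofReal (Real.exp (-(2 * β * sqNorm (u + v - u)))) * (m1 (u + v) / m2 (u + v))) := by
    intro u v
    have h1 : mixture μ sqNorm (u + a) ≤
        ENNReal.ofReal (Real.exp (sqNorm (v - a))) * m1 (u + v) := by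
      refine mixture_le_mul_mixture (by fun_prop) fun x => ?_
      have := sqNorm_add_le (u + a - x) (v - a)
      rw [show u + a - x + (v - a) = u + v - x by abel] at this
      linarith
    have h2 : m2 (u + v) ≤ ENNReal.ofReal (Real.exp (2 * β * sqNorm (v - b))) *
        mixture μ (fun z => β * sqNorm z) (u + b) := by
      refine mixture_le_mul_mixture (by fun_prop) fun x => ?_
      have := sqNorm_add_le (u + v - x) (-(v - b))
      rw [show u + v - x + -(v - b) = u + b - x by abel, sqNorm_neg] at this
      nlinarith
    have h3 : r u ≤ ENNReal.ofReal (Real.exp (sqNorm (v - a))) *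
        ENNReal.ofReal (Real.exp (2 * β * sqNorm (v - b))) * (m1 (u + v) / m2 (u + v)) := by
      refine ENNReal.div_le_of_le_mul ?_
      calc _ ≤ _ := h1
        _ = ENNReal.ofReal (Real.exp (sqNorm (v - a))) * (m1 (u + v) / m2 (u + v)) * m2 (u + v) := by
            rw [mul_assoc, ENNReal.div_mul_cancel (hm2pos _) (hm2top _)]
        _ ≤ ENNReal.ofReal (Real.exp (sqNorm (v - a))) * (m1 (u + v) / m2 (u + v)) *
            (ENNReal.ofReal (Real.exp (2 * β * sqNorm (v - b))) *
              mixture μ (fun z => β * sqNorm z) (u + b)) := by gcongr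
        _ = _ := by ring
    calc _ ≤ ENNReal.ofReal (Real.exp (sqNorm (v - a))) *
        ENNReal.ofReal (Real.exp (2 * β * sqNorm (v - b))) * (m1 (u + v) / m2 (u + v)) *
          ENNReal.ofReal (Real.exp (-(2 + 6 * β) * sqNorm v)) := by gcongr
      _ = ENNReal.ofReal (Real.exp (sqNorm (v - a) + 2 * β * sqNorm (v - b) +
            -(2 + 6 * β) * sqNorm v)) * (m1 (u + v) / m2 (u + v)) := by
          rw [Real.exp_add, Real.exp_add, ENNReal.ofReal_mul (by positivity),
            ENNReal.ofReal_mul (by positivity)]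
          ring
      _ ≤ ENNReal.ofReal (Real.exp (K + -(2 * β * sqNorm (u + v - u)))) *
            (m1 (u + v) / m2 (u + v)) := by
          refine mul_le_mul_left (ENNReal.ofReal_le_ofReal (Real.exp_le_exp.2 ?_)) _
          have h4 := sqNorm_sub_le v a
          have h5 := mul_le_mul_of_nonneg_left (sqNorm_sub_le v b) (by positivity : 0 ≤ 2 * β)
          rw [add_sub_cancel_left, hK]
          linarith
      _ = _ := by
          rw [Real.exp_add, ENNReal.ofReal_mul (by positivity), mul_assoc]
  have hβ' : 0 < 2 + 6 * β := by positivity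
  have hkey : (∫⁻ u, r u ∂μ) * ENNReal.ofReal (Real.pi / (2 + 6 * β)) ^ N ≤
      ENNReal.ofReal (Real.exp K) * ENNReal.ofReal (Real.pi / (1 / 2)) ^ N := by
    calc _ = ∫⁻ u, (∫⁻ v, r u * ENNReal.ofReal (Real.exp (-(2 + 6 * β) * sqNorm v))) ∂μ := by
          rw [← lintegral_mul_const _ hrm]
          refine lintegral_congr fun u => ?_
          rw [lintegral_const_mul _ (by fun_prop), ← lintegral_exp_neg_mul_sqNorm hβ' 0]
          simp
      _ ≤ ∫⁻ u, (∫⁻ v, ENNReal.ofReal (Real.exp K) * (ENNReal.ofReal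
            (Real.exp (-(2 * β * sqNorm (u + v - u)))) * (m1 (u + v) / m2 (u + v)))) ∂μ :=
          lintegral_mono fun u => lintegral_mono fun v => hpt u v
      _ = ∫⁻ u, (∫⁻ y, ENNReal.ofReal (Real.exp K) * (ENNReal.ofReal
            (Real.exp (-(2 * β * sqNorm (y - u)))) * (m1 y / m2 y))) ∂μ := by
          refine lintegral_congr fun u => ?_
          exact lintegral_add_left_eq_self (fun y => ENNReal.ofReal (Real.exp K) *
            (ENNReal.ofReal (Real.exp (-(2 * β * sqNorm (y - u)))) * (m1 y / m2 y))) u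
      _ = ∫⁻ y, ENNReal.ofReal (Real.exp K) * m1 y := by
          rw [lintegral_lintegral_swap (by fun_prop)]
          refine lintegral_congr fun y => ?_
          rw [lintegral_const_mul _ (by fun_prop), lintegral_mul_const _ (by fun_prop)]
          change _ * (m2 y * (m1 y / m2 y)) = _
          rw [ENNReal.mul_div_cancel (hm2pos y) (hm2top y)]
      _ = _ := by
          rw [lintegral_const_mul _ hm1m, hm1, lintegral_mixture_mul_sqNorm (by norm_num)]
  have hpos : 0 < Real.pi / (2 + 6 * β) := by positivity
  rw [← ENNReal.ofReal_pow hpos.le, ← ENNReal.ofReal_pow (by positivity),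
    ← ENNReal.ofReal_mul (by positivity)] at hkey
  have := ENNReal.le_div_iff_mul_le (Or.inl (by simpa using by positivity))
    (Or.inl ENNReal.ofReal_ne_top) |>.2 hkey
  refine this.trans_eq ?_
  rw [← ENNReal.ofReal_div_of_pos (by positivity)]
  congr 1
  rw [mul_div_assoc, ← div_pow]
  congr 2
  field_simp

lemma log_toReal_div {p q : ℝ≥0∞} (hp : p ≠ 0) (hp' : p ≠ ∞) (hq : q ≠ 0) (hq' : q ≠ ∞) :
    Real.log (p / q).toReal = Real.log p.toReal - Real.log q.toReal := by
  rw [ENNReal.toReal_div, Real.log_div (ENNReal.toReal_ne_zero.2 ⟨hp, hp'⟩)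
    (ENNReal.toReal_ne_zero.2 ⟨hq, hq'⟩)]

/-- The mean of the logarithm of a Gaussian mixture changes by a bounded amount when the noise
level and the point at which it is evaluated are changed. -/
lemma integral_logMix_add_le (hμ : Integrable sqNorm μ) {β : ℝ} (hβ : 0 < β) (a b : ι → ℂ) :
    ∫ u, logMix μ sqNorm (u + a) ∂μ ≤ ∫ u, logMix μ (fun z => β * sqNorm z) (u + b) ∂μ +
      (Fintype.card ι * Real.log (2 * (2 + 6 * β)) + 2 * sqNorm a + 4 * β * sqNorm b) := by
  have hm := measurable_sqNorm (ι := ι)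
  have hQ := quadBound_mul_sqNorm (ι := ι) hβ.le
  have h1m : Measurable (mixture μ sqNorm) := measurable_mixture hm
  have h2m : Measurable (mixture μ (fun z => β * sqNorm z)) := measurable_mixture (by fun_prop)
  have hi1 : Integrable (fun u => logMix μ sqNorm (u + a)) μ :=
    integrable_logMix_comp hm sqNorm_nonneg zero_le_one quadBound_sqNorm.le hμ (by fun_prop)
      (integrable_sqNorm_add hμ a)
  have hi2 : Integrable (fun u => logMix μ (fun z => β * sqNorm z) (u + b)) μ :=
    integrable_logMix_comp hQ.measurable hQ.nonneg hQ.const_nonneg hQ.le hμ (by fun_prop)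
      (integrable_sqNorm_add hμ b)
  have hlog : ∀ u, Real.log (mixture μ sqNorm (u + a) /
      mixture μ (fun z => β * sqNorm z) (u + b)).toReal =
      logMix μ sqNorm (u + a) - logMix μ (fun z => β * sqNorm z) (u + b) := fun u =>
    log_toReal_div (mixture_pos hm _).ne' (mixture_ne_top sqNorm_nonneg _)
      (mixture_pos hQ.measurable _).ne' (mixture_ne_top hQ.nonneg _)
  -- Jensen: the mean of the log-ratio is at most the logarithm of the mean ratio.
  have h := integral_log_toReal_le (P := μ) (f := fun u => mixture μ sqNorm (u + a) /
      mixture μ (fun z => β * sqNorm z) (u + b)) (by fun_prop) (fun u => ENNReal.toReal_pos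
        (ENNReal.div_pos (mixture_pos hm _).ne' (mixture_ne_top hQ.nonneg _)).ne'
        (ENNReal.div_ne_top (mixture_ne_top sqNorm_nonneg _) (mixture_pos hQ.measurable _).ne'))
      (by simp_rw [hlog]; exact hi1.sub hi2) (by positivity) (lintegral_mixture_ratio_le hβ a b)
  simp_rw [hlog] at h
  rw [integral_sub hi1 hi2, Real.log_mul (by positivity) (by positivity), Real.log_exp,
    Real.log_pow] at h
  linarith

end Comparison

end MeanLogMixture

/-! ### Submodularity of mean log-mixtures -/

section Submodularity

variable {ι : Type*}

/-- The squared norm of the coordinates in `s`. -/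
noncomputable def sqNormOn (s : Finset ι) (z : ι → ℂ) : ℝ := ∑ i ∈ s, ‖z i‖ ^ 2

lemma measurable_sqNormOn (s : Finset ι) : Measurable (sqNormOn s) := by
  unfold sqNormOn; fun_prop

lemma sqNormOn_nonneg (s : Finset ι) (z : ι → ℂ) : 0 ≤ sqNormOn s z :=
  Finset.sum_nonneg fun _ _ => by positivity

lemma sqNormOn_congr {s : Finset ι} {z z' : ι → ℂ} (h : ∀ i ∈ s, z i = z' i) :
    sqNormOn s z = sqNormOn s z' :=
  Finset.sum_congr rfl fun i hi => by rw [h i hi]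

lemma sqNormOn_union [DecidableEq ι] {s t : Finset ι} (h : Disjoint s t) (z : ι → ℂ) :
    sqNormOn (s ∪ t) z = sqNormOn s z + sqNormOn t z :=
  Finset.sum_union h

/-- A function that does not depend on the coordinates in `s`. -/
def IndepOn {β : Type*} (s : Finset ι) (f : (ι → ℂ) → β) : Prop :=
  ∀ ⦃x y : ι → ℂ⦄, (∀ i ∉ s, x i = y i) → f x = f y

lemma indepOn_sqNormOn {s t : Finset ι} (h : Disjoint s t) : IndepOn s (sqNormOn t) :=
  fun _ _ hxy => sqNormOn_congr fun i hi => hxy i fun his => Finset.disjoint_left.1 h his hi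

lemma IndepOn.mixture {s : Finset ι} {H : (ι → ℂ) → ℝ} (hH : IndepOn s H) (μ : Measure (ι → ℂ)) :
    IndepOn s (mixture μ H) := by
  intro x y hxy
  unfold _root_.mixture
  refine lintegral_congr fun z => ?_
  rw [hH (x := x - z) (y := y - z) fun i hi => by simp [hxy i hi]]

section Marginal

variable [DecidableEq ι]

lemma updateFinset_of_notMem {s : Finset ι} (x : ι → ℂ) (y : ∀ _ : s, ℂ) {i : ι} (hi : i ∉ s) :
    Function.updateFinset x s y i = x i := by
  simp [Function.updateFinset, hi]

/-- Pulling a factor out of a partial integral. -/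
lemma lmarginal_mul_of_indepOn {s : Finset ι} {Φ g : (ι → ℂ) → ℝ≥0∞} (hg : Measurable g)
    (hΦ : IndepOn s Φ) :
    lmarginal (fun _ => volume) s (fun x => Φ x * g x) =
      fun x => Φ x * lmarginal (fun _ => volume) s g x := by
  ext x
  simp only [lmarginal]
  rw [← lintegral_const_mul (f := fun y => g (Function.updateFinset x s y)) _
    (hg.comp measurable_updateFinset)]
  refine lintegral_congr fun y => ?_
  rw [hΦ (fun i hi => updateFinset_of_notMem x y hi)]

/-- Integrating a Gaussian mixture over some orthogonal coordinates. -/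
lemma lmarginal_mixture [Fintype ι] (μ : Measure (ι → ℂ)) [IsProbabilityMeasure μ] {s : Finset ι}
    {H : (ι → ℂ) → ℝ} (hHm : Measurable H) (hH : IndepOn s H) :
    lmarginal (fun _ => volume) s (mixture μ fun z => H z + sqNormOn s z) =
      fun x => mixture μ H x * ENNReal.ofReal Real.pi ^ s.card := by
  have hs := measurable_sqNormOn s
  ext x
  simp only [lmarginal, mixture]
  rw [lintegral_lintegral_swap
    (by have := measurable_updateFinset (X := fun _ : ι => ℂ) (s := s) (x := x); fun_prop)]
  rw [← lintegral_mul_const _ (by fun_prop)]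
  refine lintegral_congr fun z => ?_
  have h1 := lintegral_exp_neg_mul_sqNorm (ι := s) one_pos (fun i => z i)
  simp only [div_one, Fintype.card_coe] at h1
  rw [← h1, ← lintegral_const_mul _ (by have := measurable_sqNorm (ι := s); fun_prop)]
  refine lintegral_congr fun y => ?_
  rw [← ENNReal.ofReal_mul (Real.exp_pos _).le, ← Real.exp_add,
    hH (x := Function.updateFinset x s y - z) (y := x - z)
      fun i hi => by simp [updateFinset_of_notMem x y hi]]
  congr 3
  have : sqNormOn s (Function.updateFinset x s y - z) = sqNorm (y - fun i : s => z i) := by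
    rw [sqNormOn, sqNorm, ← Finset.sum_coe_sort]
    refine Finset.sum_congr rfl fun i _ => ?_
    simp [Function.updateFinset]
  rw [this]; ring

end Marginal

variable [Fintype ι]

/-- Integration of the four-fold ratio of mixtures, in coordinates that split into four groups. -/
lemma lintegral_mixture_sqNormOn_ratio [DecidableEq ι] (μ : Measure (ι → ℂ)) [IsProbabilityMeasure μ]
    {w a b r : Finset ι} (hwa : Disjoint w a) (hab : Disjoint a b)
    (hr : Disjoint (w ∪ a ∪ b) r) (huniv : w ∪ a ∪ b ∪ r = Finset.univ) {H : (ι → ℂ) → ℝ}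
    (hHm : Measurable H) (hH0 : ∀ z, 0 ≤ H z) (hH : IndepOn r H) :
    ∫⁻ x, mixture μ (sqNormOn (w ∪ a)) x * mixture μ (sqNormOn (w ∪ b)) x /
      (mixture μ H x * mixture μ (sqNormOn w) x) * mixture μ (fun z => H z + sqNormOn r z) x =
      ENNReal.ofReal Real.pi ^ Fintype.card ι := by
  have hm : ∀ {R : (ι → ℂ) → ℝ}, Measurable R → Measurable (mixture μ R) := measurable_mixture
  have m1 := hm (measurable_sqNormOn (w ∪ a))
  have m2 := hm (measurable_sqNormOn (w ∪ b))
  have m3 := hm hHm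
  have m4 := hm (measurable_sqNormOn w)
  have m5 : Measurable (mixture μ (fun z => H z + sqNormOn r z)) :=
    hm (hHm.add (measurable_sqNormOn r))
  have hne : ∀ {R : (ι → ℂ) → ℝ}, Measurable R → (∀ z, 0 ≤ R z) → ∀ x, mixture μ R x ≠ 0 ∧
      mixture μ R x ≠ ∞ := fun hR hR0 x => ⟨(mixture_pos hR x).ne', mixture_ne_top hR0 x⟩
  rw [Finset.disjoint_union_left, Finset.disjoint_union_left] at hr
  obtain ⟨⟨hwr, har⟩, hbr⟩ := hr
  set f := fun x => mixture μ (sqNormOn (w ∪ a)) x * mixture μ (sqNormOn (w ∪ b)) x /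
      (mixture μ H x * mixture μ (sqNormOn w) x) * mixture μ (fun z => H z + sqNormOn r z) x with hf
  set P := ENNReal.ofReal Real.pi with hP
  -- Over r only the last factor varies; its integral is π^|r| times the mixture of H, which
  -- cancels.
  have step1 : lmarginal (fun _ => volume) r f = fun x =>
      (P ^ r.card * mixture μ (sqNormOn (w ∪ b)) x / mixture μ (sqNormOn w) x) *
        mixture μ (sqNormOn (w ∪ a)) x := by
    rw [hf, lmarginal_mul_of_indepOn m5, lmarginal_mixture μ hHm hH]
    · ext x
      obtain ⟨h1, h2⟩ := hne hHm hH0 x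
      simp only [div_eq_mul_inv]
      rw [ENNReal.mul_inv (Or.inl h1) (Or.inl h2)]
      calc _ = (mixture μ H x * (mixture μ H x)⁻¹) * (P ^ r.card * mixture μ (sqNormOn (w ∪ b)) x *
            (mixture μ (sqNormOn w) x)⁻¹ * mixture μ (sqNormOn (w ∪ a)) x) := by ring
        _ = _ := by rw [ENNReal.mul_inv_cancel h1 h2, one_mul]
    · intro x y hxy
      dsimp only
      rw [(indepOn_sqNormOn (t := w ∪ a) (by simp [hwr.symm, har.symm])).mixture μ hxy, hH.mixture μ hxy,
        (indepOn_sqNormOn (t := w ∪ b) (by simp [hwr.symm, hbr.symm])).mixture μ hxy,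
        (indepOn_sqNormOn hwr.symm).mixture μ hxy]
  -- Over a only the mixture of w ∪ a varies; its integral is π^|a| times the mixture of w, which
  -- cancels.
  have step2 : lmarginal (fun _ => volume) a (lmarginal (fun _ => volume) r f) = fun x =>
      (P ^ r.card * P ^ a.card) * mixture μ (sqNormOn (w ∪ b)) x := by
    have h0 := lmarginal_mixture μ (measurable_sqNormOn w) (indepOn_sqNormOn hwa.symm)
    rw [show (fun z => sqNormOn w z + sqNormOn a z) = sqNormOn (w ∪ a) from
      funext fun z => (sqNormOn_union hwa z).symm] at h0
    rw [step1, lmarginal_mul_of_indepOn m1, h0]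
    · ext x
      obtain ⟨h1, h2⟩ := hne (measurable_sqNormOn w) (sqNormOn_nonneg w) x
      simp only [div_eq_mul_inv]
      calc _ = (mixture μ (sqNormOn w) x * (mixture μ (sqNormOn w) x)⁻¹) *
            (P ^ r.card * P ^ a.card * mixture μ (sqNormOn (w ∪ b)) x) := by ring
        _ = _ := by rw [ENNReal.mul_inv_cancel h1 h2, one_mul]
    · intro x y hxy
      dsimp only
      rw [(indepOn_sqNormOn (t := w ∪ b) (by simp [hwa.symm, hab])).mixture μ hxy,
        (indepOn_sqNormOn hwa.symm).mixture μ hxy]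
  have hd1 : Disjoint a r := har
  have hd2 : Disjoint (w ∪ b) (a ∪ r) := by
    simp only [Finset.disjoint_union_left, Finset.disjoint_union_right]
    exact ⟨⟨hwa, hab.symm⟩, hwr, hbr⟩
  have hu : (Finset.univ : Finset ι) = (w ∪ b) ∪ (a ∪ r) := by
    rw [← huniv]; ext i; simp only [Finset.mem_union]; tauto
  have hfm : Measurable f := by fun_prop
  rw [volume_pi, lintegral_eq_lmarginal_univ (μ := fun _ : ι => (volume : Measure ℂ)) (f := f) 0, hu,
    lmarginal_union _ f hfm hd2, lmarginal_union _ f hfm hd1, step2,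
    lmarginal_mul_of_indepOn m2 (fun _ _ _ => rfl)]
  -- The remaining factor is integrated over all its coordinates: with H = 0 the mixture left is the
  -- total mass 1.
  have h0 := lmarginal_mixture μ (s := w ∪ b) (H := fun _ => 0) measurable_const (fun _ _ _ => rfl)
  simp only [zero_add] at h0
  rw [show (fun z => sqNormOn (w ∪ b) z) = sqNormOn (w ∪ b) from rfl] at h0
  rw [h0]
  have h1 : mixture μ (fun _ => 0) (0 : ι → ℂ) = 1 := by simp [mixture]
  dsimp only
  rw [h1, one_mul, ← pow_add, ← pow_add]
  congr 1
  rw [← Finset.card_univ, hu, Finset.card_union_of_disjoint hd2, Finset.card_union_of_disjoint hd1]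
  ring

/-- Change of variables by a linear bijection whose inverse is bounded by `C`. -/
lemma lintegral_comp_linearEquiv_le (T : (ι → ℂ) ≃ₗ[ℂ] (ι → ℂ)) {C : ℝ} (hC : 0 < C)
    (hT : ∀ z, ‖z‖ ≤ C * ‖T z‖) {f : (ι → ℂ) → ℝ≥0∞} (hf : Measurable f) :
    ∫⁻ y, f (T y) ≤ ENNReal.ofReal (C ^ (2 * Fintype.card ι)) * ∫⁻ x, f x := by
  set S : (ι → ℂ) →ₗ[ℝ] (ι → ℂ) := T.toLinearMap.restrictScalars ℝ with hS
  have hcont : Continuous S := S.continuous_of_finiteDimensional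
  have hdet : LinearMap.det S ≠ 0 := (LinearEquiv.isUnit_det' (T.restrictScalars ℝ)).ne_zero
  have hmap := Measure.map_linearMap_addHaar_eq_smul_addHaar (volume : Measure (ι → ℂ)) hdet
  -- The preimage of the unit ball lies in the ball of radius C. As the image measure is |det|⁻¹
  -- times Lebesgue measure, this bounds |det|⁻¹ by C to the real dimension.
  have hball : Measure.map S volume (Metric.ball 0 1) ≤
      ENNReal.ofReal (C ^ (2 * Fintype.card ι)) * (volume : Measure (ι → ℂ)) (Metric.ball 0 1) := by
    rw [Measure.map_apply hcont.measurable measurableSet_ball]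
    have hr : Module.finrank ℝ (ι → ℂ) = 2 * Fintype.card ι := by
      rw [Module.finrank_pi_fintype]; simp [Complex.finrank_real_complex, mul_comm]
    rw [← hr, ← Measure.addHaar_ball_of_pos _ 0 hC]
    refine measure_mono fun z hz => ?_
    simp only [Set.mem_preimage, Metric.mem_ball, dist_zero_right] at hz ⊢
    calc ‖z‖ ≤ C * ‖T z‖ := hT z
      _ < C * 1 := by gcongr; exact hz
      _ = C := mul_one C
  have hscale : ENNReal.ofReal |(LinearMap.det S)⁻¹| ≤ ENNReal.ofReal (C ^ (2 * Fintype.card ι)) := by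
    rw [hmap, Measure.smul_apply, smul_eq_mul] at hball
    exact (ENNReal.mul_le_mul_iff_left (Metric.measure_ball_pos _ _ one_pos).ne'
      measure_ball_lt_top.ne).1 hball
  calc ∫⁻ y, f (T y) = ∫⁻ x, f x ∂(Measure.map S volume) :=
        (lintegral_map hf hcont.measurable).symm
    _ ≤ _ := by
        rw [hmap, lintegral_smul_measure, smul_eq_mul]
        gcongr

lemma mixture_comp_linearEquiv (μ : Measure (ι → ℂ)) (T : (ι → ℂ) ≃ₗ[ℂ] (ι → ℂ))
    {R : (ι → ℂ) → ℝ} (hR : Measurable R) (y : ι → ℂ) :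
    mixture μ (fun z => R (T z)) y = mixture (μ.map T) R (T y) := by
  have hT : Measurable T := (T.toLinearMap.continuous_of_finiteDimensional).measurable
  unfold mixture
  rw [lintegral_map (by fun_prop) hT]
  simp

/-- Submodularity of the mean log-mixtures, up to the logarithm of a Jacobian. -/
lemma meanLogMix_submodular [DecidableEq ι] {μ : Measure (ι → ℂ)} [IsProbabilityMeasure μ]
    (hμ : Integrable sqNorm μ) {QS QV QJ QI : (ι → ℂ) → ℝ} (hS : QuadBound QS 1)
    (hV : QuadBound QV 1) (hJ : QuadBound QJ 1) (hI : QuadBound QI 1)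
    (T : (ι → ℂ) ≃ₗ[ℂ] (ι → ℂ)) {w a b r : Finset ι} (hwa : Disjoint w a)
    (hab : Disjoint a b) (hr : Disjoint (w ∪ a ∪ b) r) (huniv : w ∪ a ∪ b ∪ r = Finset.univ)
    (eS : ∀ z, QS z = sqNormOn (w ∪ a) (T z)) (eV : ∀ z, QV z = sqNormOn (w ∪ b) (T z))
    (eI : ∀ z, QI z = sqNormOn w (T z)) (eJ : ∀ z, sqNorm z = QJ z + sqNormOn r (T z))
    (hJr : ∀ z z', (∀ i ∉ r, T z i = T z' i) → QJ z = QJ z')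
    {C : ℝ} (hC : 0 < C) (hT : ∀ z, ‖z‖ ≤ C * ‖T z‖) :
    meanLogMix μ QS + meanLogMix μ QV ≤ meanLogMix μ QJ + meanLogMix μ QI +
      2 * Fintype.card ι * Real.log C := by
  have hTm : Measurable T := (T.toLinearMap.continuous_of_finiteDimensional).measurable
  have hTm' : Measurable T.symm := (T.symm.toLinearMap.continuous_of_finiteDimensional).measurable
  set H : (ι → ℂ) → ℝ := fun x => QJ (T.symm x) with hH
  have hHm : Measurable H := hJ.measurable.comp hTm'
  have : IsProbabilityMeasure (μ.map T) := Measure.isProbabilityMeasure_map hTm.aemeasurable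
  have hlin := lintegral_mixture_sqNormOn_ratio (μ.map T) hwa hab hr huniv hHm
    (fun z => hJ.nonneg _) (fun x y hxy => hJr _ _ (by simpa using hxy))
  have hm : ∀ {ν : Measure (ι → ℂ)} [IsProbabilityMeasure ν] {R : (ι → ℂ) → ℝ}, Measurable R →
    Measurable (mixture ν R) := measurable_mixture
  have n1 := hm (ν := μ) hS.measurable
  have n2 := hm (ν := μ) hV.measurable
  have n3 := hm (ν := μ) hJ.measurable
  have n4 := hm (ν := μ) hI.measurable
  have n5 := hm (ν := μ) (measurable_sqNorm (ι := ι))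
  -- The density of X + Z is π^(-|ι|) times the mixture of `sqNorm` = QJ + `sqNormOn r` ∘ T, so in
  -- the coordinates T the integrand is that of `lintegral_mixture_sqNormOn_ratio`.
  have hratio : ∫⁻ y, mixture μ QS y * mixture μ QV y / (mixture μ QJ y * mixture μ QI y)
      ∂(μ.conv (stdComplexGaussian ι)) ≤ ENNReal.ofReal (C ^ (2 * Fintype.card ι)) := by
    have m1 := hm (ν := μ.map T) (measurable_sqNormOn (w ∪ a))
    have m2 := hm (ν := μ.map T) (measurable_sqNormOn (w ∪ b))
    have m3 := hm (ν := μ.map T) hHm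
    have m4 := hm (ν := μ.map T) (measurable_sqNormOn w)
    have m5 : Measurable (mixture (μ.map T) (fun z => H z + sqNormOn r z)) :=
      hm (hHm.add (measurable_sqNormOn r))
    rw [conv_stdComplexGaussian, lintegral_withDensity_eq_lintegral_mul _ (by fun_prop)
      (by fun_prop)]
    have hc := lintegral_comp_linearEquiv_le T hC hT (f := fun x =>
      mixture (μ.map T) (sqNormOn (w ∪ a)) x * mixture (μ.map T) (sqNormOn (w ∪ b)) x /
      (mixture (μ.map T) H x * mixture (μ.map T) (sqNormOn w) x) *
        mixture (μ.map T) (fun z => H z + sqNormOn r z) x) (by fun_prop)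
    rw [hlin] at hc
    have e1 : mixture μ QS = fun y => mixture (μ.map T) (sqNormOn (w ∪ a)) (T y) := by
      ext y; rw [← mixture_comp_linearEquiv μ T (measurable_sqNormOn _), ← funext eS]
    have e2 : mixture μ QV = fun y => mixture (μ.map T) (sqNormOn (w ∪ b)) (T y) := by
      ext y; rw [← mixture_comp_linearEquiv μ T (measurable_sqNormOn _), ← funext eV]
    have e3 : mixture μ QI = fun y => mixture (μ.map T) (sqNormOn w) (T y) := by
      ext y; rw [← mixture_comp_linearEquiv μ T (measurable_sqNormOn _), ← funext eI]
    have e4 : mixture μ QJ = fun y => mixture (μ.map T) H (T y) := by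
      ext y; rw [← mixture_comp_linearEquiv μ T hHm]; simp [hH]
    have e5 : mixture μ sqNorm =
        fun y => mixture (μ.map T) (fun z => H z + sqNormOn r z) (T y) := by
      ext y
      rw [← mixture_comp_linearEquiv μ T (R := fun z => H z + sqNormOn r z)
        (hHm.add (measurable_sqNormOn r))]
      simp only [hH, LinearEquiv.symm_apply_apply]
      rw [← funext eJ]
    simp only [Pi.mul_apply]
    rw [e1, e2, e3, e4, e5]
    calc _ = ENNReal.ofReal (Real.pi ^ Fintype.card ι)⁻¹ * ∫⁻ y,
          mixture (μ.map T) (sqNormOn (w ∪ a)) (T y) * mixture (μ.map T) (sqNormOn (w ∪ b)) (T y) /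
          (mixture (μ.map T) H (T y) * mixture (μ.map T) (sqNormOn w) (T y)) *
          mixture (μ.map T) (fun z => H z + sqNormOn r z) (T y) := by
          rw [← lintegral_const_mul _ (by fun_prop)]
          refine lintegral_congr fun y => ?_
          ring
      _ ≤ _ := mul_le_mul_right hc _
      _ = _ := by
          rw [← ENNReal.ofReal_pow Real.pi_pos.le, mul_left_comm,
            ← ENNReal.ofReal_mul (by positivity), inv_mul_cancel₀ (by positivity),
            ENNReal.ofReal_one, mul_one]
  set ν := μ.conv (stdComplexGaussian ι) with hν
  have hν2 : Integrable sqNorm ν := integrable_sqNorm_conv hμ integrable_sqNorm_stdComplexGaussian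
  have i1 := hS.integrable_logMix hμ hν2
  have i2 := hV.integrable_logMix hμ hν2
  have i3 := hJ.integrable_logMix hμ hν2
  have i4 := hI.integrable_logMix hμ hν2
  have hne : ∀ {R : (ι → ℂ) → ℝ}, QuadBound R 1 → ∀ x, mixture μ R x ≠ 0 ∧
      mixture μ R x ≠ ∞ := fun hR x => ⟨(mixture_pos hR.measurable x).ne',
        mixture_ne_top hR.nonneg x⟩
  have hnum : ∀ y, mixture μ QS y * mixture μ QV y ≠ 0 ∧ mixture μ QS y * mixture μ QV y ≠ ∞ :=
    fun y => ⟨mul_ne_zero (hne hS y).1 (hne hV y).1, ENNReal.mul_ne_top (hne hS y).2 (hne hV y).2⟩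
  have hden : ∀ y, mixture μ QJ y * mixture μ QI y ≠ 0 ∧ mixture μ QJ y * mixture μ QI y ≠ ∞ :=
    fun y => ⟨mul_ne_zero (hne hJ y).1 (hne hI y).1, ENNReal.mul_ne_top (hne hJ y).2 (hne hI y).2⟩
  have hlogmul : ∀ {p q : ℝ≥0∞}, (p ≠ 0 ∧ p ≠ ∞) → (q ≠ 0 ∧ q ≠ ∞) →
      Real.log (p * q).toReal = Real.log p.toReal + Real.log q.toReal := by
    intro p q hp hq
    rw [ENNReal.toReal_mul, Real.log_mul (ENNReal.toReal_ne_zero.2 hp) (ENNReal.toReal_ne_zero.2 hq)]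
  have hlog : ∀ y, Real.log
      (mixture μ QS y * mixture μ QV y / (mixture μ QJ y * mixture μ QI y)).toReal =
      (logMix μ QS y + logMix μ QV y) - (logMix μ QJ y + logMix μ QI y) := by
    intro y
    rw [log_toReal_div (hnum y).1 (hnum y).2 (hden y).1 (hden y).2, hlogmul (hne hS y) (hne hV y),
      hlogmul (hne hJ y) (hne hI y)]
    rfl
  have h := integral_log_toReal_le (P := ν) (by fun_prop) (fun y => ENNReal.toReal_pos
        (ENNReal.div_pos (hnum y).1 (hden y).2).ne' (ENNReal.div_ne_top (hnum y).2 (hden y).1))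
      (by simp_rw [hlog]; exact (i1.add i2).sub (i3.add i4)) (by positivity) hratio
  simp_rw [hlog] at h
  rw [integral_sub (f := fun y => logMix μ QS y + logMix μ QV y)
    (g := fun y => logMix μ QJ y + logMix μ QI y) (i1.add i2) (i3.add i4), integral_add i1 i2, integral_add i3 i4,
    Real.log_pow] at h
  unfold meanLogMix
  rw [← hν]
  push_cast at h
  linarith

end Submodularity

/-! ### Orthogonal projections and splittings -/

section OrthogonalSplitting

variable {E : Type*} [NormedAddCommGroup E] [InnerProductSpace ℂ E] [FiniteDimensional ℂ E]

lemma norm_sq_starProjection_eq_sum (S : Submodule ℂ E) (x : E) :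
    ‖S.starProjection x‖ ^ 2 = ∑ i, ‖inner ℂ (stdOrthonormalBasis ℂ S i : E) x‖ ^ 2 := by
  rw [Submodule.starProjection_apply, ← Submodule.coe_norm,
    ← (stdOrthonormalBasis ℂ S).sum_sq_norm_inner_right]
  refine Finset.sum_congr rfl fun i _ => ?_
  rw [Submodule.coe_inner, ← Submodule.starProjection_apply,
    ← Submodule.inner_starProjection_left_eq_right, Submodule.starProjection_eq_self_iff.2 (SetLike.coe_mem _)]

lemma norm_sq_starProjection_add {W S : Submodule ℂ E} (h : W ≤ S) (x : E) :
    ‖S.starProjection x‖ ^ 2 =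
      ‖W.starProjection x‖ ^ 2 + ‖(Wᗮ ⊓ S).starProjection x‖ ^ 2 := by
  have hW := W.starProjection_apply_mem x
  have hA := (Wᗮ ⊓ S).starProjection_apply_mem x
  have heq : S.starProjection x = W.starProjection x + (Wᗮ ⊓ S).starProjection x := by
    refine Submodule.eq_starProjection_of_mem_orthogonal (S.add_mem (h hW) hA.2) ?_
    have h1 := W.sub_starProjection_mem_orthogonal x
    have h2 := (Wᗮ ⊓ S).sub_starProjection_mem_orthogonal x
    -- S is the orthogonal sum of W and Wᗮ ⊓ S, so being orthogonal to S can be tested on the two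
    -- summands.
    have hperp : Sᗮ = Wᗮ ⊓ (Wᗮ ⊓ S)ᗮ := by
      rw [Submodule.inf_orthogonal, Submodule.sup_orthogonal_inf_of_hasOrthogonalProjection h]
    rw [hperp]
    refine ⟨?_, ?_⟩
    · rw [← sub_sub]; exact Submodule.sub_mem _ h1 hA.1
    · rw [add_comm, ← sub_sub]
      exact Submodule.sub_mem _ h2
        (Submodule.orthogonal_le inf_le_left (Submodule.le_orthogonal_orthogonal W hW))
  have := norm_add_sq_eq_norm_sq_add_norm_sq_of_inner_eq_zero (𝕜 := ℂ) _ _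
    (Submodule.inner_right_of_mem_orthogonal hW hA.1)
  rw [heq, sq, this]; ring

lemma norm_sq_eq_starProjection_add (S : Submodule ℂ E) (x : E) :
    ‖x‖ ^ 2 = ‖S.starProjection x‖ ^ 2 + ‖Sᗮ.starProjection x‖ ^ 2 := by
  have h := norm_sq_starProjection_add (le_top : S ≤ ⊤) x
  rw [Submodule.starProjection_eq_self_iff.2 Submodule.mem_top] at h
  simpa only [inf_top_eq] using h

lemma starProjection_sup_eq_zero {S V : Submodule ℂ E} {x : E} (hS : S.starProjection x = 0)
    (hV : V.starProjection x = 0) : (S ⊔ V).starProjection x = 0 := by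
  rw [Submodule.starProjection_apply_eq_zero_iff] at *
  rw [← Submodule.inf_orthogonal]
  exact ⟨hS, hV⟩

end OrthogonalSplitting

/-! ### The quadratic form of a subspace of ℂ^M -/

section ProjForm

variable {M : ℕ}

/-- Subspaces of `ℂ^M`, regarded as subspaces of the Euclidean space. -/
noncomputable def toEuclid (M : ℕ) :
    Submodule ℂ (Fin M → ℂ) ≃o Submodule ℂ (EuclideanSpace ℂ (Fin M)) :=
  Submodule.orderIsoMapComap (WithLp.linearEquiv 2 ℂ (Fin M → ℂ)).symm

lemma mem_toEuclid {S : Submodule ℂ (Fin M → ℂ)} {x : EuclideanSpace ℂ (Fin M)} :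
    x ∈ toEuclid M S ↔ x.ofLp ∈ S := by
  change x ∈ Submodule.map _ S ↔ _
  constructor
  · rintro ⟨y, hy, rfl⟩; exact hy
  · intro h; exact ⟨x.ofLp, h, rfl⟩

/-- The entrywise complex conjugate of a vector, in the Euclidean space. -/
noncomputable def conjVec (z : Fin M → ℂ) : EuclideanSpace ℂ (Fin M) := WithLp.toLp 2 (star z)

lemma conjVec_sub (z z' : Fin M → ℂ) : conjVec (z - z') = conjVec z - conjVec z' := by
  simp [conjVec]

/-- The problem pairs vectors bilinearly, through a transpose, while the inner product is
conjugate-linear in its first argument; conjugating z reconciles the two in absolute value. -/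
lemma norm_inner_conjVec (e : EuclideanSpace ℂ (Fin M)) (z : Fin M → ℂ) :
    ‖inner ℂ e (conjVec z)‖ = ‖∑ i, e i * z i‖ := by
  rw [← norm_star (∑ i, e i * z i), EuclideanSpace.inner_eq_star_dotProduct]
  simp [dotProduct, conjVec, mul_comm]

lemma norm_sq_conjVec (z : Fin M → ℂ) : ‖conjVec z‖ ^ 2 = sqNorm z := by
  simp [EuclideanSpace.norm_sq_eq, conjVec, sqNorm]

lemma continuous_conjVec : Continuous (conjVec : (Fin M → ℂ) → EuclideanSpace ℂ (Fin M)) := by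
  unfold conjVec; fun_prop

/-- The squared norm of the restriction to `S` of the linear functional `b ↦ ∑ i, b i * z i`, which
is the squared norm of the coordinates of `z` in an orthonormal basis of `S`. -/
noncomputable def projForm (S : Submodule ℂ (Fin M → ℂ)) (z : Fin M → ℂ) : ℝ :=
  ‖(toEuclid M S).starProjection (conjVec z)‖ ^ 2

lemma projForm_eq {S : Submodule ℂ (Fin M → ℂ)} {K : Submodule ℂ (EuclideanSpace ℂ (Fin M))}
    (h : toEuclid M S = K) (z : Fin M → ℂ) :
    projForm S z = ‖K.starProjection (conjVec z)‖ ^ 2 := by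
  subst h; rfl

lemma continuous_projForm (S : Submodule ℂ (Fin M → ℂ)) : Continuous (projForm S) := by
  have := continuous_conjVec (M := M)
  unfold projForm
  fun_prop

lemma projForm_nonneg (S : Submodule ℂ (Fin M → ℂ)) (z : Fin M → ℂ) : 0 ≤ projForm S z :=
  sq_nonneg _

lemma projForm_le_sqNorm (S : Submodule ℂ (Fin M → ℂ)) (z : Fin M → ℂ) :
    projForm S z ≤ sqNorm z := by
  rw [← norm_sq_conjVec]
  exact pow_le_pow_left₀ (norm_nonneg _) (Submodule.norm_starProjection_apply_le _ _) 2

lemma projForm_top (z : Fin M → ℂ) : projForm ⊤ z = sqNorm z := by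
  rw [← norm_sq_conjVec, projForm_eq (OrderIso.map_top _),
    Submodule.starProjection_eq_self_iff.2 Submodule.mem_top]

lemma projForm_bot (z : Fin M → ℂ) : projForm ⊥ z = 0 := by
  simp [projForm]

/-- Cauchy-Schwarz for a bilinear pairing. -/
lemma norm_sum_mul_sq_le {κ : Type*} [Fintype κ] (c z : κ → ℂ) :
    ‖∑ j, c j * z j‖ ^ 2 ≤ sqNorm c * sqNorm z := by
  calc _ ≤ (∑ j, ‖c j‖ * ‖z j‖) ^ 2 := by
        refine pow_le_pow_left₀ (norm_nonneg _) ((norm_sum_le _ _).trans_eq ?_) 2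
        simp
    _ ≤ _ := Finset.sum_mul_sq_le_sq_mul_sq _ _ _

lemma exists_sum_norm_sq_le {m : ℕ} (b : Fin m → Fin M → ℂ) :
    ∃ β : ℝ, 0 < β ∧ ∀ z : Fin M → ℂ, ∑ j, ‖∑ i, b j i * z i‖ ^ 2 ≤ β * sqNorm z := by
  refine ⟨∑ j, sqNorm (b j) + 1, ?_, fun z => ?_⟩
  · have := Finset.sum_nonneg fun j (_ : j ∈ Finset.univ) => sqNorm_nonneg (b j)
    linarith
  · calc _ ≤ ∑ j, sqNorm (b j) * sqNorm z := Finset.sum_le_sum fun j _ => norm_sum_mul_sq_le _ _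
      _ = (∑ j, sqNorm (b j)) * sqNorm z := (Finset.sum_mul _ _ _).symm
      _ ≤ _ := mul_le_mul_of_nonneg_right (by linarith) (sqNorm_nonneg z)

/-- An orthonormal basis of the span has coefficients c with respect to b, and Cauchy-Schwarz bounds
the form by the sum of their squares. The added 1 makes the constant positive. -/
lemma exists_projForm_span_le {m : ℕ} (b : Fin m → Fin M → ℂ) :
    ∃ β : ℝ, 0 < β ∧ ∀ z : Fin M → ℂ,
      projForm (Submodule.span ℂ (Set.range b)) z ≤ β * ∑ j, ‖∑ i, b j i * z i‖ ^ 2 := by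
  set S := Submodule.span ℂ (Set.range b)
  have he : ∀ k, ∃ c : Fin m → ℂ,
      ∑ j, c j • b j = (stdOrthonormalBasis ℂ (toEuclid M S) k : EuclideanSpace ℂ (Fin M)).ofLp :=
    fun k => (Submodule.mem_span_range_iff_exists_fun ℂ).1 (mem_toEuclid.1 (SetLike.coe_mem _))
  choose c hc using he
  refine ⟨∑ k, sqNorm (c k) + 1, ?_, fun z => ?_⟩
  · have := Finset.sum_nonneg fun k (_ : k ∈ Finset.univ) => sqNorm_nonneg (c k)
    linarith
  · have h0 : 0 ≤ ∑ j, ‖∑ i, b j i * z i‖ ^ 2 := Finset.sum_nonneg fun _ _ => by positivity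
    calc projForm S z = ∑ k, ‖∑ j, c k j * ∑ i, b j i * z i‖ ^ 2 := by
          rw [projForm, norm_sq_starProjection_eq_sum]
          refine Finset.sum_congr rfl fun k _ => ?_
          rw [norm_inner_conjVec, ← hc k]
          congr 2
          simp only [Finset.sum_apply, Pi.smul_apply, smul_eq_mul, Finset.sum_mul, Finset.mul_sum]
          rw [Finset.sum_comm]
          simp only [mul_assoc]
      _ ≤ ∑ k, sqNorm (c k) * ∑ j, ‖∑ i, b j i * z i‖ ^ 2 :=
          Finset.sum_le_sum fun k _ => norm_sum_mul_sq_le _ _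
      _ = (∑ k, sqNorm (c k)) * ∑ j, ‖∑ i, b j i * z i‖ ^ 2 := (Finset.sum_mul _ _ _).symm
      _ ≤ _ := mul_le_mul_of_nonneg_right (by linarith) h0

/-- Coordinates of `ℂ^M` in four groups (colours `0, 1, 2, 3`) that diagonalize the forms of two
subspaces `S` and `V`, their intersection (colour `0`) and their sum (colours `0, 1, 2`). -/
structure SplitCoords (S V : Submodule ℂ (Fin M → ℂ)) where
  /-- the coordinates -/
  T : (Fin M → ℂ) ≃ₗ[ℂ] (Fin M → ℂ)
  /-- the group that a coordinate belongs to -/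
  col : Fin M → Fin 4
  left : ∀ z, projForm S z = ∑ i, if col i = 0 ∨ col i = 1 then ‖T z i‖ ^ 2 else 0
  right : ∀ z, projForm V z = ∑ i, if col i = 0 ∨ col i = 2 then ‖T z i‖ ^ 2 else 0
  inf : ∀ z, projForm (S ⊓ V) z = ∑ i, if col i = 0 then ‖T z i‖ ^ 2 else 0
  sup : ∀ z, sqNorm z = projForm (S ⊔ V) z + ∑ i, if col i = 3 then ‖T z i‖ ^ 2 else 0
  sup_congr : ∀ z z', (∀ i, col i ≠ 3 → T z i = T z' i) → projForm (S ⊔ V) z = projForm (S ⊔ V) z'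

/-- The coordinates are pairings with orthonormal bases of W = S ⊓ V, of its orthogonal complements
A in S and B in V, and of R = (S ⊔ V)ᗮ. A and B need not be orthogonal to each other, so T is not
unitary in general; this is the source of the Jacobian. -/
lemma nonempty_splitCoords (S V : Submodule ℂ (Fin M → ℂ)) : Nonempty (SplitCoords S V) := by
  set S' := toEuclid M S with hS'
  set V' := toEuclid M V with hV'
  set W := S' ⊓ V' with hW
  set A := Wᗮ ⊓ S' with hA
  set B := Wᗮ ⊓ V' with hB
  set R := (S' ⊔ V')ᗮ with hR
  let κ := (Fin (Module.finrank ℂ W) ⊕ Fin (Module.finrank ℂ A)) ⊕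
    (Fin (Module.finrank ℂ B) ⊕ Fin (Module.finrank ℂ R))
  let e : κ → EuclideanSpace ℂ (Fin M) := Sum.elim
    (Sum.elim (fun i => (stdOrthonormalBasis ℂ W i : EuclideanSpace ℂ (Fin M)))
      fun i => (stdOrthonormalBasis ℂ A i : EuclideanSpace ℂ (Fin M)))
    (Sum.elim (fun i => (stdOrthonormalBasis ℂ B i : EuclideanSpace ℂ (Fin M)))
      fun i => (stdOrthonormalBasis ℂ R i : EuclideanSpace ℂ (Fin M)))
  let c : κ → Fin 4 := Sum.elim (Sum.elim (fun _ => 0) fun _ => 1) (Sum.elim (fun _ => 2) fun _ => 3)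
  -- The dimension formula for S ⊔ V and S ⊓ V makes the four bases have M vectors together.
  have hcard : Fintype.card κ = M := by
    simp only [κ, Fintype.card_sum, Fintype.card_fin]
    have h1 : Module.finrank ℂ W + Module.finrank ℂ A = Module.finrank ℂ S' :=
      Submodule.finrank_add_inf_finrank_orthogonal inf_le_left
    have h2 : Module.finrank ℂ W + Module.finrank ℂ B = Module.finrank ℂ V' :=
      Submodule.finrank_add_inf_finrank_orthogonal inf_le_right
    have h3 : Module.finrank ℂ ↥(S' ⊔ V') + Module.finrank ℂ R = M :=
      (Submodule.finrank_add_finrank_orthogonal (S' ⊔ V')).trans finrank_euclideanSpace_fin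
    have h4 : Module.finrank ℂ ↥(S' ⊔ V') + Module.finrank ℂ W =
      Module.finrank ℂ S' + Module.finrank ℂ V' := Submodule.finrank_sup_add_finrank_inf_eq S' V'
    omega
  let ε : κ ≃ Fin M := Fintype.equivFinOfCardEq hcard
  let T₀ : (Fin M → ℂ) →ₗ[ℂ] (Fin M → ℂ) :=
    (Matrix.of fun k i => e (ε.symm k) i).mulVecLin
  have hT₀ : ∀ z k, ‖T₀ z (ε k)‖ = ‖inner ℂ (e k) (conjVec z)‖ := by
    intro z k
    rw [norm_inner_conjVec]
    simp [T₀, Matrix.mulVec, dotProduct]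
  -- With suitable 0-1 weights f on the colours, this one identity gives all the forms below.
  have hsum : ∀ (f : Fin 4 → ℝ) (z : Fin M → ℂ),
      ∑ i, f (c (ε.symm i)) * ‖T₀ z i‖ ^ 2 =
      (f 0 * ‖W.starProjection (conjVec z)‖ ^ 2 + f 1 * ‖A.starProjection (conjVec z)‖ ^ 2) +
      (f 2 * ‖B.starProjection (conjVec z)‖ ^ 2 + f 3 * ‖R.starProjection (conjVec z)‖ ^ 2) := by
    intro f z
    rw [← ε.sum_comp]
    simp only [Equiv.symm_apply_apply, hT₀, norm_sq_starProjection_eq_sum, Finset.mul_sum]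
    rw [Fintype.sum_sum_type, Fintype.sum_sum_type, Fintype.sum_sum_type]
    rfl
  have hSf : ∀ x, ‖S'.starProjection x‖ ^ 2 = ‖W.starProjection x‖ ^ 2 + ‖A.starProjection x‖ ^ 2 :=
    norm_sq_starProjection_add inf_le_left
  have hVf : ∀ x, ‖V'.starProjection x‖ ^ 2 = ‖W.starProjection x‖ ^ 2 + ‖B.starProjection x‖ ^ 2 :=
    norm_sq_starProjection_add inf_le_right
  have hJf : ∀ x, ‖x‖ ^ 2 = ‖(S' ⊔ V').starProjection x‖ ^ 2 + ‖R.starProjection x‖ ^ 2 :=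
    norm_sq_eq_starProjection_add _
  have hzero : ∀ z, (∀ i, c (ε.symm i) ≠ 3 → T₀ z i = 0) →
      (S' ⊔ V').starProjection (conjVec z) = 0 := by
    intro z hz
    have h1 := hsum (fun j => if j ≠ 3 then 1 else 0) z
    rw [Finset.sum_eq_zero fun i _ => ?_] at h1
    · simp only [ne_eq, Fin.reduceEq, not_false_eq_true, if_true, not_true_eq_false, if_false,
        one_mul, zero_mul, add_zero] at h1
      have n1 := sq_nonneg ‖W.starProjection (conjVec z)‖
      have n2 := sq_nonneg ‖A.starProjection (conjVec z)‖
      have n3 := sq_nonneg ‖B.starProjection (conjVec z)‖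
      apply starProjection_sup_eq_zero
      · rw [← norm_eq_zero, ← sq_eq_zero_iff, hSf]; linarith
      · rw [← norm_eq_zero, ← sq_eq_zero_iff, hVf]; linarith
    · split_ifs with h
      · simp [hz i h]
      · simp
  -- If all coordinates vanish, so do the projections to S ⊔ V and to its orthogonal complement,
  -- hence the vector.
  have hinj : Function.Injective T₀ := by
    rw [← LinearMap.ker_eq_bot, LinearMap.ker_eq_bot']
    intro z hz
    have h1 := hzero z fun i _ => by rw [hz]; rfl
    have h2 := hsum (fun j => if j = 3 then 1 else 0) z
    rw [Finset.sum_eq_zero fun i _ => by simp [hz]] at h2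
    simp only [Fin.reduceEq, if_true, if_false, zero_mul, one_mul, zero_add] at h2
    have h3 := hJf (conjVec z)
    rw [h1, ← h2, norm_sq_conjVec] at h3
    simp only [norm_zero, ne_eq, OfNat.ofNat_ne_zero, not_false_eq_true, zero_pow, add_zero] at h3
    ext i
    have := (Finset.sum_eq_zero_iff_of_nonneg fun i _ => by positivity).1 h3 i (Finset.mem_univ i)
    simpa using this
  refine ⟨⟨LinearEquiv.ofInjectiveEndo T₀ hinj, fun i => c (ε.symm i), fun z => ?_, fun z => ?_,
    fun z => ?_, fun z => ?_, fun z z' h => ?_⟩⟩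
  · simp only [LinearEquiv.coe_ofInjectiveEndo]
    have h := hsum (fun j => if j = 0 ∨ j = 1 then 1 else 0) z
    simp only [ite_mul, one_mul, zero_mul] at h
    rw [h, projForm_eq hS'.symm, hSf]
    simp
  · simp only [LinearEquiv.coe_ofInjectiveEndo]
    have h := hsum (fun j => if j = 0 ∨ j = 2 then 1 else 0) z
    simp only [ite_mul, one_mul, zero_mul] at h
    rw [h, projForm_eq hV'.symm, hVf]
    simp
  · simp only [LinearEquiv.coe_ofInjectiveEndo]
    have h := hsum (fun j => if j = 0 then 1 else 0) z
    simp only [ite_mul, one_mul, zero_mul] at h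
    rw [h, projForm_eq (K := W) (OrderIso.map_inf _ _ _)]
    simp
  · simp only [LinearEquiv.coe_ofInjectiveEndo]
    have h := hsum (fun j => if j = 3 then 1 else 0) z
    simp only [ite_mul, one_mul, zero_mul] at h
    rw [h, projForm_eq (K := S' ⊔ V') (OrderIso.map_sup _ _ _), ← norm_sq_conjVec, hJf]
    simp
  · simp only [LinearEquiv.coe_ofInjectiveEndo] at h
    have h1 := hzero (z - z') fun i hi => by rw [map_sub, Pi.sub_apply, h i hi, sub_self]
    rw [conjVec_sub, map_sub, sub_eq_zero] at h1
    rw [projForm_eq (K := S' ⊔ V') (OrderIso.map_sup _ _ _),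
      projForm_eq (K := S' ⊔ V') (OrderIso.map_sup _ _ _), h1]

end ProjForm

/-! ### Blocks of n channel uses -/

section BlockForm

variable {n M : ℕ}

/-- The form of the subspace `∏ t, S t` of `(ℂ^M)^n`. -/
noncomputable def blockForm (S : Fin n → Submodule ℂ (Fin M → ℂ)) (z : Fin n × Fin M → ℂ) : ℝ :=
  ∑ t, projForm (S t) fun i => z (t, i)

lemma sqNorm_eq_sum_blocks {m : ℕ} (z : Fin n × Fin m → ℂ) :
    sqNorm z = ∑ t, sqNorm fun i => z (t, i) := Fintype.sum_prod_type _

lemma quadBound_blockForm (S : Fin n → Submodule ℂ (Fin M → ℂ)) : QuadBound (blockForm S) 1 where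
  measurable := by
    refine Finset.measurable_fun_sum _ fun t _ => ?_
    exact (continuous_projForm (S t)).measurable.comp (by fun_prop)
  nonneg z := Finset.sum_nonneg fun t _ => projForm_nonneg _ _
  const_nonneg := zero_le_one
  le z := by
    rw [one_mul, sqNorm_eq_sum_blocks]
    exact Finset.sum_le_sum fun t _ => projForm_le_sqNorm _ _

lemma blockForm_top : blockForm (⊤ : Fin n → Submodule ℂ (Fin M → ℂ)) = sqNorm := by
  ext z
  rw [sqNorm_eq_sum_blocks]
  exact Finset.sum_congr rfl fun t _ => projForm_top _

lemma meanLogMix_blockForm_bot {μ : Measure (Fin n × Fin M → ℂ)} [IsProbabilityMeasure μ] :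
    meanLogMix μ (blockForm (⊥ : Fin n → Submodule ℂ (Fin M → ℂ))) = 0 := by
  have h : blockForm (⊥ : Fin n → Submodule ℂ (Fin M → ℂ)) = fun _ => 0 := by
    ext z
    exact Finset.sum_eq_zero fun t _ => projForm_bot _
  simp [meanLogMix, h, logMix, mixture]

lemma LinearEquiv.exists_norm_le_mul_norm {V W : Type*} [NormedAddCommGroup V] [NormedSpace ℂ V]
    [FiniteDimensional ℂ V] [NormedAddCommGroup W] [NormedSpace ℂ W] (T : V ≃ₗ[ℂ] W) :
    ∃ C : ℝ, 1 ≤ C ∧ ∀ z, ‖z‖ ≤ C * ‖T z‖ := by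
  obtain ⟨K, -, hK⟩ := T.toLinearMap.exists_antilipschitzWith T.ker
  refine ⟨max K 1, le_max_right _ _, fun z => ?_⟩
  have h := hK.le_mul_dist z 0
  simp only [dist_zero_right, LinearEquiv.coe_coe, map_zero] at h
  exact h.trans (mul_le_mul_of_nonneg_right (le_max_left _ _) (norm_nonneg _))

lemma sqNormOn_filter_blocks {m : ℕ} (p : Fin n × Fin m → Prop) [DecidablePred p]
    (z : Fin n × Fin m → ℂ) :
    sqNormOn (Finset.univ.filter p) z =
      ∑ t, ∑ i, if p (t, i) then ‖z (t, i)‖ ^ 2 else 0 := by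
  rw [sqNormOn, Finset.sum_filter, Fintype.sum_prod_type]

/-- There is a cost function on pairs of subspaces that controls the defect of submodularity of the
mean log-mixtures of product subspaces. -/
lemma exists_cost_meanLogMix_submodular (M : ℕ) :
    ∃ cost : Submodule ℂ (Fin M → ℂ) → Submodule ℂ (Fin M → ℂ) → ℝ,
    ∀ (n : ℕ) (μ : Measure (Fin n × Fin M → ℂ)) [IsProbabilityMeasure μ], Integrable sqNorm μ →
    ∀ (S V : Fin n → Submodule ℂ (Fin M → ℂ)) (C : ℝ), 1 ≤ C → (∀ t, cost (S t) (V t) ≤ C) →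
    meanLogMix μ (blockForm S) + meanLogMix μ (blockForm V) ≤
      meanLogMix μ (blockForm (S ⊔ V)) + meanLogMix μ (blockForm (S ⊓ V)) +
        n * (2 * M * Real.log C) := by
  have hex : ∀ S V : Submodule ℂ (Fin M → ℂ), ∃ (c : SplitCoords S V) (C : ℝ), 1 ≤ C ∧
      ∀ z, ‖z‖ ≤ C * ‖c.T z‖ := fun S V => by
    obtain ⟨c⟩ := nonempty_splitCoords S V
    exact ⟨c, c.T.exists_norm_le_mul_norm⟩
  -- The cost of a pair bounds the inverse of its coordinate change; it knows nothing of n or μ.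
  choose sc cost _ hcost using hex
  refine ⟨cost, fun n μ _ hμ S V C hC hle => ?_⟩
  let T : (Fin n × Fin M → ℂ) ≃ₗ[ℂ] (Fin n × Fin M → ℂ) :=
    (LinearEquiv.curry ℂ ℂ (Fin n) (Fin M)).trans
      ((LinearEquiv.piCongrRight fun t => (sc (S t) (V t)).T).trans
        (LinearEquiv.curry ℂ ℂ (Fin n) (Fin M)).symm)
  have hT : ∀ z t i, T z (t, i) = (sc (S t) (V t)).T (fun j => z (t, j)) i := fun z t i => rfl
  let col : Fin n × Fin M → Fin 4 := fun p => (sc (S p.1) (V p.1)).col p.2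
  have hcoleq : ∀ t i, col (t, i) = (sc (S t) (V t)).col i := fun t i => rfl
  have hun : ∀ a b : Fin 4, Finset.univ.filter (fun p => col p = a) ∪
      Finset.univ.filter (fun p => col p = b) = Finset.univ.filter (fun p => col p = a ∨ col p = b) :=
    fun a b => (Finset.filter_or _ _ _).symm
  have hdisj : ∀ {a b : Fin 4}, a ≠ b → Disjoint (Finset.univ.filter (fun p => col p = a))
      (Finset.univ.filter (fun p => col p = b)) := fun hab =>
    Finset.disjoint_filter.2 fun p _ h1 h2 => hab (h1.symm.trans h2)
  have hmain := meanLogMix_submodular hμ (quadBound_blockForm S) (quadBound_blockForm V)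
    (quadBound_blockForm (S ⊔ V)) (quadBound_blockForm (S ⊓ V)) T
    (w := Finset.univ.filter (fun p => col p = 0)) (a := Finset.univ.filter (fun p => col p = 1))
    (b := Finset.univ.filter (fun p => col p = 2)) (r := Finset.univ.filter (fun p => col p = 3))
    (hdisj (by decide)) (hdisj (by decide))
    (by simp only [Finset.disjoint_union_left]
        exact ⟨⟨hdisj (by decide), hdisj (by decide)⟩, hdisj (by decide)⟩)
    (by ext p
        simp only [Finset.mem_union, Finset.mem_filter, Finset.mem_univ, true_and, iff_true]
        generalize col p = c
        revert c
        decide)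
    (fun z => by
      rw [hun, sqNormOn_filter_blocks]
      exact Finset.sum_congr rfl fun t _ => (sc (S t) (V t)).left _)
    (fun z => by
      rw [hun, sqNormOn_filter_blocks]
      exact Finset.sum_congr rfl fun t _ => (sc (S t) (V t)).right _)
    (fun z => by
      rw [sqNormOn_filter_blocks]
      exact Finset.sum_congr rfl fun t _ => (sc (S t) (V t)).inf _)
    (fun z => by
      rw [sqNormOn_filter_blocks, sqNorm_eq_sum_blocks, blockForm, ← Finset.sum_add_distrib]
      exact Finset.sum_congr rfl fun t _ => (sc (S t) (V t)).sup _)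
    (fun z z' h => by
      refine Finset.sum_congr rfl fun t _ => (sc (S t) (V t)).sup_congr _ _ fun i hi => ?_
      rw [← hT, ← hT]
      exact h (t, i) (by simpa using hi))
    (C := C) (by linarith)
    (fun z => by
      -- In the sup norm, a block-diagonal inverse is bounded by any common bound of its blocks, so
      -- C does not grow with n.
      refine (pi_norm_le_iff_of_nonneg (by positivity)).2 fun p => ?_
      calc ‖z p‖ ≤ ‖fun j => z (p.1, j)‖ := norm_le_pi_norm (fun j => z (p.1, j)) p.2
        _ ≤ cost (S p.1) (V p.1) * ‖(sc (S p.1) (V p.1)).T fun j => z (p.1, j)‖ := hcost _ _ _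
        _ ≤ C * ‖T z‖ := by
          refine mul_le_mul (hle _) ?_ (norm_nonneg _) (by linarith)
          refine (pi_norm_le_iff_of_nonneg (norm_nonneg _)).2 fun i => ?_
          rw [← hT]
          exact norm_le_pi_norm (T z) (p.1, i))
  refine hmain.trans_eq ?_
  rw [Fintype.card_prod, Fintype.card_fin, Fintype.card_fin]
  push_cast
  ring

end BlockForm

/-! ### From the noise of the projected vector to the full noise -/

section NoiseComparison

/-- Jensen for exp(‖Z‖²/2), whose mean is 2^|ι|. A bound linear in the dimension is all that is
needed. -/
lemma integral_sqNorm_stdComplexGaussian_le {ι : Type*} [Fintype ι] :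
    ∫ z : ι → ℂ, sqNorm z ∂(stdComplexGaussian ι) ≤ 2 * (Fintype.card ι * Real.log 2) := by
  have hm := measurable_sqNorm (ι := ι)
  have h := integral_log_toReal_le (P := stdComplexGaussian ι)
    (f := fun z => ENNReal.ofReal (Real.exp (1 / 2 * sqNorm z))) (C := 2 ^ Fintype.card ι)
    (by fun_prop) (fun z => by rw [ENNReal.toReal_ofReal (Real.exp_pos _).le]; exact Real.exp_pos _)
    (by
      simp_rw [ENNReal.toReal_ofReal (Real.exp_pos _).le, Real.log_exp]
      exact integrable_sqNorm_stdComplexGaussian.const_mul _)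
    (by positivity)
    (by
      rw [stdComplexGaussian_eq, lintegral_withDensity_eq_lintegral_mul _ (by fun_prop)
        (by fun_prop)]
      simp only [Pi.mul_apply, mul_assoc]
      rw [lintegral_const_mul _ (by fun_prop)]
      have h1 : ∀ z : ι → ℂ, ENNReal.ofReal (Real.exp (-sqNorm z)) *
          ENNReal.ofReal (Real.exp (1 / 2 * sqNorm z)) =
          ENNReal.ofReal (Real.exp (-(1 / 2) * sqNorm (z - 0))) := fun z => by
        rw [← ENNReal.ofReal_mul (Real.exp_pos _).le, ← Real.exp_add, sub_zero]
        ring_nf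
      simp_rw [h1]
      rw [lintegral_exp_neg_mul_sqNorm (by norm_num), ← ENNReal.ofReal_pow (by positivity),
        ← ENNReal.ofReal_mul (by positivity), ← inv_pow, ← mul_pow]
      refine le_of_eq ?_
      congr 2
      field_simp)
  simp_rw [ENNReal.toReal_ofReal (Real.exp_pos _).le, Real.log_exp] at h
  rw [integral_const_mul, Real.log_pow] at h
  linarith

variable {ι κ : Type*} [Fintype ι] [Fintype κ]

/-- Fubini with the noise fixed and the signal averaged first, the form in which
`integral_logMix_add_le` applies. -/
lemma QuadBound.meanLogMix_eq {μ : Measure (ι → ℂ)} [IsProbabilityMeasure μ] {Q : (ι → ℂ) → ℝ}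
    {c : ℝ} (hQ : QuadBound Q c) (hμ : Integrable sqNorm μ) :
    meanLogMix μ Q = ∫ a, ∫ u, logMix μ Q (u + a) ∂μ ∂(stdComplexGaussian ι) := by
  have hi := hQ.integrable_logMix hμ
    (integrable_sqNorm_conv integrable_sqNorm_stdComplexGaussian hμ)
  rw [meanLogMix, Measure.conv_comm, integral_conv hi]
  simp_rw [add_comm]

lemma QuadBound.integrable_logMix_add {μ : Measure (ι → ℂ)} [IsProbabilityMeasure μ]
    {Q : (ι → ℂ) → ℝ} {c : ℝ} (hQ : QuadBound Q c) (hμ : Integrable sqNorm μ)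
    {ν : Measure (κ → ℂ)} [IsProbabilityMeasure ν] (hν : Integrable sqNorm ν)
    {X : (κ → ℂ) → ι → ℂ} (hX : Measurable X) {K : ℝ} (hK : ∀ x, sqNorm (X x) ≤ K * sqNorm x) :
    Integrable (fun a => ∫ u, logMix μ Q (u + X a) ∂μ) ν := by
  refine Integrable.integral_prod_left (f := fun p : (κ → ℂ) × (ι → ℂ) =>
    logMix μ Q (p.2 + X p.1)) ?_
  refine integrable_logMix_comp hQ.measurable hQ.nonneg hQ.const_nonneg hQ.le hμ
    (by fun_prop) ?_
  refine Integrable.mono' (((hμ.comp_snd ν).const_mul 2).add (((hν.comp_fst μ).const_mul (2 * K))))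
    (measurable_sqNorm.comp (by fun_prop)).aestronglyMeasurable (ae_of_all _ fun p => ?_)
  rw [Real.norm_of_nonneg (sqNorm_nonneg _)]
  have := sqNorm_add_le p.2 (X p.1)
  have := hK p.1
  simp only [Pi.add_apply]
  linarith

/-- The noisy entropy of a linear image of a random vector is bounded below by the mean log-mixture
of a form that is dominated by the linear map. -/
lemma neg_meanLogMix_le_diffEntropy_map {μ : Measure (ι → ℂ)} [IsProbabilityMeasure μ]
    (hμ : Integrable sqNorm μ) {Q : (ι → ℂ) → ℝ} (hQ : QuadBound Q 1) (B : (ι → ℂ) →ₗ[ℂ] (κ → ℂ))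
    {β γ : ℝ} (hβ : 0 < β) (hγ : 0 < γ) (hQB : ∀ z, Q z ≤ β * sqNorm (B z))
    (hBγ : ∀ z, sqNorm (B z) ≤ γ * sqNorm z) :
    -meanLogMix μ Q - (Fintype.card κ * (Real.log (2 * (2 + 6 * β)) + 4 * Real.log 2) +
      Fintype.card ι * (8 * β * γ * Real.log 2)) ≤
      diffEntropy ((μ.map B).conv (stdComplexGaussian κ)) := by
  have hBm : Measurable B := (LinearMap.continuous_of_finiteDimensional B).measurable
  have : IsProbabilityMeasure (μ.map B) := Measure.isProbabilityMeasure_map hBm.aemeasurable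
  set ν := μ.map B with hν
  have hν2 : Integrable sqNorm ν := by
    rw [hν, integrable_map_measure measurable_sqNorm.aestronglyMeasurable hBm.aemeasurable]
    refine Integrable.mono' (hμ.const_mul γ) (measurable_sqNorm.comp hBm).aestronglyMeasurable
      (ae_of_all _ fun z => ?_)
    rw [Function.comp_apply, Real.norm_of_nonneg (sqNorm_nonneg _)]
    exact hBγ z
  have hβQ := quadBound_mul_sqNorm (ι := κ) hβ.le
  have hGκ := integrable_sqNorm_stdComplexGaussian (ι := κ)
  have hGι := integrable_sqNorm_stdComplexGaussian (ι := ι)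
  set c₁ : ℝ := Fintype.card κ * Real.log (2 * (2 + 6 * β)) with hc₁
  -- The shifts a and B z in `integral_logMix_add_le` are unrelated, so the noise a on ℂ^κ is
  -- averaged out on the left while z stays fixed.
  have step1 : ∀ z : ι → ℂ, meanLogMix ν sqNorm ≤
      ∫ u, logMix ν (fun y => β * sqNorm y) (u + B z) ∂ν +
        (c₁ + 4 * (Fintype.card κ * Real.log 2) + 4 * β * (γ * sqNorm z)) := by
    intro z
    set I := ∫ u, logMix ν (fun y => β * sqNorm y) (u + B z) ∂ν with hI
    rw [quadBound_sqNorm.meanLogMix_eq hν2]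
    calc _ ≤ ∫ a, ((I + c₁ + 4 * β * (γ * sqNorm z)) + 2 * sqNorm a) ∂(stdComplexGaussian κ) := by
          refine integral_mono (quadBound_sqNorm.integrable_logMix_add hν2 hGκ measurable_id
            (K := 1) fun x => (one_mul _).ge) ((integrable_const _).add (hGκ.const_mul 2))
            fun a => ?_
          have h1 := integral_logMix_add_le hν2 hβ a (B z)
          have h2 := mul_le_mul_of_nonneg_left (hBγ z) (by positivity : 0 ≤ 4 * β)
          linarith
      _ = (I + c₁ + 4 * β * (γ * sqNorm z)) + 2 * ∫ a, sqNorm a ∂(stdComplexGaussian κ) := by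
          rw [integral_add (integrable_const _) (hGκ.const_mul 2), integral_const_mul]
          simp
      _ ≤ _ := by
          have := integral_sqNorm_stdComplexGaussian_le (ι := κ)
          linarith
  have hint := hβQ.integrable_logMix_add hν2 hGι hBm hBγ
  -- Now z is averaged over the noise on ℂ^ι.
  have step2 : meanLogMix ν sqNorm ≤
      ∫ z, ∫ u, logMix ν (fun y => β * sqNorm y) (u + B z) ∂ν ∂(stdComplexGaussian ι) +
        (c₁ + 4 * (Fintype.card κ * Real.log 2) +
          4 * β * (γ * (2 * (Fintype.card ι * Real.log 2)))) := by
    have hi2 : Integrable (fun z : ι → ℂ => 4 * β * (γ * sqNorm z)) (stdComplexGaussian ι) :=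
      (hGι.const_mul γ).const_mul _
    calc _ = ∫ _ : ι → ℂ, meanLogMix ν sqNorm ∂(stdComplexGaussian ι) := by simp
      _ ≤ ∫ z, (∫ u, logMix ν (fun y => β * sqNorm y) (u + B z) ∂ν +
            (c₁ + 4 * (Fintype.card κ * Real.log 2) + 4 * β * (γ * sqNorm z)))
              ∂(stdComplexGaussian ι) :=
          integral_mono (integrable_const _) (hint.add ((integrable_const _).add hi2)) step1
      _ = ∫ z, ∫ u, logMix ν (fun y => β * sqNorm y) (u + B z) ∂ν ∂(stdComplexGaussian ι) +
            (c₁ + 4 * (Fintype.card κ * Real.log 2) + 4 * β * (γ * ∫ z, sqNorm z ∂(stdComplexGaussian ι))) := by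
          rw [integral_add (g := fun z => c₁ + 4 * (Fintype.card κ * Real.log 2) +
            4 * β * (γ * sqNorm z)) hint ((integrable_const _).add hi2),
            integral_add (integrable_const _) hi2, integral_const_mul, integral_const_mul]
          simp
      _ ≤ _ := by
          gcongr
          exact integral_sqNorm_stdComplexGaussian_le
  -- Pulled back to μ, the mixture at B (x + z) is at most the mixture of Q at x + z, pointwise by
  -- `hQB`.
  have step3 : ∫ z, ∫ u, logMix ν (fun y => β * sqNorm y) (u + B z) ∂ν ∂(stdComplexGaussian ι) ≤
      meanLogMix μ Q := by
    rw [hQ.meanLogMix_eq hμ]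
    refine integral_mono hint
      (hQ.integrable_logMix_add hμ hGι measurable_id (K := 1) fun x => (one_mul _).ge) fun z => ?_
    dsimp only [id]
    have hlm : Measurable (logMix ν fun y => β * sqNorm y) := measurable_logMix hβQ.measurable
    have hmap : ∫ u, logMix ν (fun y => β * sqNorm y) (u + B z) ∂ν =
        ∫ x, logMix ν (fun y => β * sqNorm y) (B x + B z) ∂μ :=
      integral_map (f := fun u => logMix ν (fun y => β * sqNorm y) (u + B z)) hBm.aemeasurable
        (Measurable.aestronglyMeasurable (by fun_prop))
    rw [hmap]
    refine integral_mono ?_ (integrable_logMix_comp hQ.measurable hQ.nonneg hQ.const_nonneg hQ.le hμ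
      (by fun_prop) (integrable_sqNorm_add hμ z)) fun x => ?_
    · refine integrable_logMix_comp hβQ.measurable hβQ.nonneg hβQ.const_nonneg hβQ.le hν2
        (by fun_prop) ?_
      refine Integrable.mono' ((integrable_sqNorm_add hμ z).const_mul γ)
        (measurable_sqNorm.comp (by fun_prop)).aestronglyMeasurable (ae_of_all _ fun x => ?_)
      rw [Real.norm_of_nonneg (sqNorm_nonneg _), ← map_add]
      exact hBγ _
    · refine logMix_le_logMix hβQ.measurable hQ.nonneg ?_
      have hm := measurable_sqNorm (ι := κ)
      have hQm := hQ.measurable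
      rw [mixture, mixture, hν, lintegral_map (by fun_prop) hBm]
      refine lintegral_mono fun y => ENNReal.ofReal_le_ofReal (Real.exp_le_exp.2 (neg_le_neg ?_))
      rw [← map_add, ← map_sub]
      exact hQB _
  rw [diffEntropy_conv_eq hν2]
  -- The normalizing constant of the noise is nonnegative and is dropped from the lower bound.
  have hpi : 0 ≤ Fintype.card κ * Real.log Real.pi :=
    mul_nonneg (Nat.cast_nonneg _) (Real.log_nonneg (by linarith [Real.pi_gt_three]))
  linarith

end NoiseComparison

/-! ### The collecting process as merging in a lattice -/

section Merging

/-- Merging a sequence of elements of a lattice into `S`: `S` is successively replaced by `S ⊔ V`,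
and `S ⊓ V` is left over. -/
def mergeSet {α : Type*} [Lattice α] : α → List α → α × List α
  | S, [] => (S, [])
  | S, V :: Q => ((mergeSet (S ⊔ V) Q).1, (S ⊓ V) :: (mergeSet (S ⊔ V) Q).2)

lemma mergeSet_top {α : Type*} [Lattice α] [OrderTop α] (Q : List α) :
    mergeSet ⊤ Q = (⊤, Q) := by
  induction Q with
  | nil => rfl
  | cons V Q ih => simp [mergeSet, ih]

lemma length_mergeSet_snd {α : Type*} [Lattice α] (S : α) (Q : List α) :
    (mergeSet S Q).2.length = Q.length := by
  induction Q generalizing S with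
  | nil => rfl
  | cons V Q ih => simp [mergeSet, ih]

/-- Merging has no case distinction, so it commutes with evaluation at t. Channel uses whose sets
fill up at different steps can thus be merged simultaneously in the product lattice. -/
lemma mergeSet_apply {ι α : Type*} [Lattice α] (t : ι) (S : ι → α) (Q : List (ι → α)) :
    (mergeSet S Q).1 t = (mergeSet (S t) (Q.map (· t))).1 ∧
      (mergeSet S Q).2.map (· t) = (mergeSet (S t) (Q.map (· t))).2 := by
  induction Q generalizing S with
  | nil => exact ⟨rfl, rfl⟩
  | cons V Q ih =>
    obtain ⟨h1, h2⟩ := ih (S ⊔ V)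
    exact ⟨h1, by simp only [mergeSet, List.map_cons, h2]; rfl⟩

/-- Since `⊤ ⊔ V = ⊤` and `⊤ ⊓ V = V`, a complete set may be kept open. -/
lemma fillSet_eq_mergeSet {E : Type*} [AddCommGroup E] [Module ℂ E] (S : Submodule ℂ E)
    (Q : List (Submodule ℂ E)) : fillSet S Q = mergeSet S Q := by
  induction Q generalizing S with
  | nil => rfl
  | cons V Q ih =>
    rw [fillSet]
    split_ifs with h
    · rw [h, mergeSet_top]
    · rw [ih]; rfl

/-- The sequence left over after `j` rounds of merging. -/
def mergeLeft {α : Type*} [Lattice α] [OrderBot α] (Q : List α) : ℕ → List α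
  | 0 => Q
  | j + 1 => (mergeSet ⊥ (mergeLeft Q j)).2

lemma leftover_eq_mergeLeft {E : Type*} [AddCommGroup E] [Module ℂ E] (Q : List (Submodule ℂ E))
    (j : ℕ) : leftover Q j = mergeLeft Q j := by
  induction j with
  | zero => rfl
  | succ j ih => rw [leftover, fillSet_eq_mergeSet, ih]; rfl

lemma length_mergeLeft {α : Type*} [Lattice α] [OrderBot α] (Q : List α) (j : ℕ) :
    (mergeLeft Q j).length = Q.length := by
  induction j with
  | zero => rfl
  | succ j ih => rw [mergeLeft, length_mergeSet_snd, ih]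

lemma mergeLeft_apply {ι α : Type*} [Lattice α] [OrderBot α] (t : ι) (Q : List (ι → α)) (j : ℕ) :
    (mergeLeft Q j).map (· t) = mergeLeft (Q.map (· t)) j := by
  induction j with
  | zero => rfl
  | succ j ih => rw [mergeLeft, (mergeSet_apply t _ _).2, ih]; rfl

/-- The largest cost of the steps of `mergeSet S Q`. -/
noncomputable def mergeCost {α : Type*} [Lattice α] (cost : α → α → ℝ) : α → List α → ℝ
  | _, [] => 1
  | S, V :: Q => max (cost S V) (mergeCost cost (S ⊔ V) Q)

/-- The largest cost of the steps of `j` rounds of merging. -/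
noncomputable def roundsCost {α : Type*} [Lattice α] [OrderBot α] (cost : α → α → ℝ) (Q : List α) :
    ℕ → ℝ
  | 0 => 1
  | j + 1 => max (roundsCost cost Q j) (mergeCost cost ⊥ (mergeLeft Q j))

lemma one_le_roundsCost {α : Type*} [Lattice α] [OrderBot α] (cost : α → α → ℝ) (Q : List α)
    (j : ℕ) : 1 ≤ roundsCost cost Q j := by
  induction j with
  | zero => exact le_rfl
  | succ j ih => exact ih.trans (le_max_left _ _)

section Sum

variable {ι α : Type*} [Lattice α] {cost : α → α → ℝ} {C A : ℝ} {g : (ι → α) → ℝ}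

/-- A function that is submodular up to `A` decreases by at most `A` per step of the merging. -/
lemma sum_mergeSet_le
    (hg : ∀ S V : ι → α, (∀ t, cost (S t) (V t) ≤ C) → g (S ⊔ V) + g (S ⊓ V) ≤ g S + g V + A)
    (S : ι → α) (Q : List (ι → α)) (hQ : ∀ t, mergeCost cost (S t) (Q.map (· t)) ≤ C) :
    g (mergeSet S Q).1 + ((mergeSet S Q).2.map g).sum ≤ g S + (Q.map g).sum + Q.length * A := by
  induction Q generalizing S with
  | nil => simp [mergeSet]
  | cons V Q ih =>
    have h1 := ih (S ⊔ V) fun t => (le_max_right _ _).trans (hQ t)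
    have h2 := hg S V fun t => (le_max_left _ _).trans (hQ t)
    simp only [mergeSet, List.map_cons, List.sum_cons, List.length_cons]
    push_cast
    linarith

/-- Each round starts from ⊥, which costs nothing, ends at ⊤ for every t, and keeps the length of
the sequence; so it yields one g ⊤ for at most `Q.length` errors A. -/
lemma sum_mergeLeft_le [BoundedOrder α]
    (hg : ∀ S V : ι → α, (∀ t, cost (S t) (V t) ≤ C) → g (S ⊔ V) + g (S ⊓ V) ≤ g S + g V + A)
    (hbot : g ⊥ = 0) (Q : List (ι → α)) (L : ℕ)
    (hC : ∀ t, roundsCost cost (Q.map (· t)) L ≤ C)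
    (hfull : ∀ t, ∀ j < L, (mergeSet ⊥ (mergeLeft (Q.map (· t)) j)).1 = ⊤) :
    L * g ⊤ + ((mergeLeft Q L).map g).sum ≤ (Q.map g).sum + L * (Q.length * A) := by
  induction L with
  | zero => simp [mergeLeft]
  | succ L ih =>
    have h1 := ih (fun t => (le_max_left _ _).trans (hC t)) fun t j hj => hfull t j (by omega)
    have h2 := sum_mergeSet_le hg ⊥ (mergeLeft Q L) fun t => by
      rw [mergeLeft_apply]; exact (le_max_right _ _).trans (hC t)
    have h3 : (mergeSet ⊥ (mergeLeft Q L)).1 = ⊤ := by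
      ext1 t
      rw [(mergeSet_apply t _ _).1, mergeLeft_apply]
      exact hfull t L (by omega)
    rw [h3, hbot, length_mergeLeft] at h2
    simp only [mergeLeft]
    push_cast
    linarith

end Sum

end Merging

/-! ### The entropy bound with an explicit remainder -/

section EntropyBound

variable {M K : ℕ} {l : Fin K → ℕ}

lemma spans_eq_map {n : ℕ} (b : ℕ → ∀ k, Fin (l k) → Fin M → ℂ) (t : Fin n) :
    (List.ofFn fun (k : Fin K) (t : Fin n) => Submodule.span ℂ (Set.range (b t k))).map (· t) =
      spans (b t) := by
  rw [List.map_ofFn]; rfl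

/-- The linear map `x ↦ (B(t)ᵀ x(t))_t`. -/
noncomputable def blockMap {n m : ℕ} (b : Fin n → Fin m → Fin M → ℂ) :
    (Fin n × Fin M → ℂ) →ₗ[ℂ] (Fin n × Fin m → ℂ) :=
  LinearMap.pi fun p => ∑ i, b p.1 p.2 i • LinearMap.proj (p.1, i)

lemma blockMap_apply {n m : ℕ} (b : Fin n → Fin m → Fin M → ℂ) (z : Fin n × Fin M → ℂ)
    (p : Fin n × Fin m) : blockMap b z p = ∑ i, b p.1 p.2 i * z (p.1, i) := by
  simp [blockMap, LinearMap.sum_apply]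

lemma sqNorm_blockMap {n m : ℕ} (b : Fin n → Fin m → Fin M → ℂ) (z : Fin n × Fin M → ℂ) :
    sqNorm (blockMap b z) = ∑ t, ∑ j, ‖∑ i, b t j i * z (t, i)‖ ^ 2 := by
  simp only [sqNorm, blockMap_apply]
  exact Fintype.sum_prod_type _

/-- The remainder in the entropy bound, in terms of the constant `C` that controls the bases. -/
noncomputable def remainder (M K L : ℕ) (l : Fin K → ℕ) (C : ℝ) : ℝ :=
  L * (M * Real.log Real.pi) + L * (K * (2 * M * Real.log C)) +
    ∑ k, (l k * (Real.log (2 * (2 + 6 * C)) + 4 * Real.log 2) + M * (8 * C * C * Real.log 2))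

lemma measurable_stack {Ω : Type*} [MeasurableSpace Ω] {n : ℕ} {X : Fin n → Ω → Fin M → ℂ}
    (hX : ∀ t, Measurable (X t)) : Measurable (stack X) :=
  measurable_pi_lambda _ fun p => (measurable_pi_apply p.2).comp (hX p.1)

lemma integrable_sqNorm_stack {Ω : Type*} [MeasurableSpace Ω] {P : Measure Ω} {n : ℕ}
    {X : Fin n → Ω → Fin M → ℂ} (hX : ∀ t, Measurable (X t)) {ρ : ℝ}
    (h : (∑ t, ∫⁻ ω, ∑ i, ‖X t ω i‖ₑ ^ 2 ∂P) ≤ n * ENNReal.ofReal ρ) :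
    Integrable sqNorm (P.map (stack X)) := by
  have hs := measurable_stack hX
  rw [integrable_map_measure measurable_sqNorm.aestronglyMeasurable hs.aemeasurable]
  refine ⟨(measurable_sqNorm.comp hs).aestronglyMeasurable, ?_⟩
  rw [hasFiniteIntegral_iff_ofReal (f := sqNorm ∘ stack X) (ae_of_all _ fun ω => sqNorm_nonneg _)]
  have heq : ∀ ω, ENNReal.ofReal (sqNorm (stack X ω)) = ∑ t, ∑ i, ‖X t ω i‖ₑ ^ 2 := by
    intro ω
    rw [sqNorm, ENNReal.ofReal_sum_of_nonneg fun _ _ => by positivity, Fintype.sum_prod_type]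
    refine Finset.sum_congr rfl fun t _ => Finset.sum_congr rfl fun i _ => ?_
    rw [ENNReal.ofReal_pow (norm_nonneg _), ofReal_norm]
    rfl
  simp only [Function.comp_apply, heq]
  rw [lintegral_finsetSum (f := fun t ω => ∑ i, ‖X t ω i‖ₑ ^ 2) _ fun t _ => by
    have := hX t
    fun_prop]
  exact h.trans_lt (ENNReal.mul_lt_top (by simp) ENNReal.ofReal_lt_top)

/-- The entropy bound with an explicit remainder, governed by a function of the bases. -/
lemma exists_noisyEntropyBound_remainder (M : ℕ) {K : ℕ} (l : Fin K → ℕ) (L : ℕ) :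
    ∃ R : (∀ k, Fin (l k) → Fin M → ℂ) → ℝ,
    ∀ b : ℕ → ∀ k, Fin (l k) → Fin M → ℂ, (∀ t, L ≤ numCompleteSets (spans (b t))) →
    ∀ (n : ℕ) (C : ℝ), 1 ≤ C → (∀ t < n, R (b t) ≤ C) →
      NoisyEntropyBound.{u} b L n fun _ => -remainder M K L l C := by
  obtain ⟨cost, hcost⟩ := exists_cost_meanLogMix_submodular M
  have hβ := fun (b : ∀ k, Fin (l k) → Fin M → ℂ) k => exists_projForm_span_le (b k)
  have hγ := fun (b : ∀ k, Fin (l k) → Fin M → ℂ) k => exists_sum_norm_sq_le (b k)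
  choose β hβ0 hβ using hβ
  choose γ hγ0 hγ using hγ
  -- A sum of nonnegative terms, so that one bound C controls the comparison constants of all the
  -- bases and the costs of all the merging steps.
  refine ⟨fun b => ∑ k, (β b k + γ b k) + roundsCost cost (spans b) L,
    fun b hL n C hC hR ρ _ Ω _ P _ X hX hpow => ?_⟩
  have hs := measurable_stack hX
  set μ := P.map (stack X) with hμdef
  have : IsProbabilityMeasure μ := Measure.isProbabilityMeasure_map hs.aemeasurable
  have hμ : Integrable sqNorm μ := integrable_sqNorm_stack hX hpow
  have hβγ0 : ∀ b, ∀ k ∈ Finset.univ, 0 ≤ β b k + γ b k := fun b k _ =>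
    add_nonneg (hβ0 b k).le (hγ0 b k).le
  have hβC : ∀ (t : Fin n) k, β (b t) k ≤ C ∧ γ (b t) k ≤ C := by
    intro t k
    have h1 := Finset.single_le_sum (hβγ0 (b t)) (Finset.mem_univ k)
    have h2 := one_le_roundsCost cost (spans (b t)) L
    have h3 := hR t t.2
    have h4 := (hβ0 (b t) k).le
    have h5 := (hγ0 (b t) k).le
    constructor <;> linarith
  have hrounds : ∀ t : Fin n, roundsCost cost (spans (b t)) L ≤ C := fun t => by
    have h1 := Finset.sum_nonneg (hβγ0 (b t))
    have h3 := hR t t.2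
    linarith
  set V : Fin K → Fin n → Submodule ℂ (Fin M → ℂ) :=
    fun k t => Submodule.span ℂ (Set.range (b t k)) with hV
  have hproj : ∀ k, -meanLogMix μ (blockForm (V k)) -
      (n * l k * (Real.log (2 * (2 + 6 * C)) + 4 * Real.log 2) +
        n * M * (8 * C * C * Real.log 2)) ≤ hbar P (projStack (fun t : Fin n => b t k) X) := by
    intro k
    have h := neg_meanLogMix_le_diffEntropy_map hμ (quadBound_blockForm (V k))
      (blockMap fun t : Fin n => b t k) (β := C) (γ := C) (by linarith) (by linarith)
      (fun z => by
        rw [sqNorm_blockMap, Finset.mul_sum]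
        refine Finset.sum_le_sum fun t _ => (hβ (b t) k _).trans ?_
        exact mul_le_mul_of_nonneg_right (hβC t k).1 (Finset.sum_nonneg fun _ _ => by positivity))
      (fun z => by
        rw [sqNorm_blockMap, sqNorm_eq_sum_blocks, Finset.mul_sum]
        refine Finset.sum_le_sum fun t _ => (hγ (b t) k _).trans ?_
        exact mul_le_mul_of_nonneg_right (hβC t k).2 (sqNorm_nonneg _))
    rw [hμdef, Measure.map_map (LinearMap.continuous_of_finiteDimensional _).measurable hs,
      ← hμdef] at h
    have hcomp : blockMap (fun t : Fin n => b t k) ∘ stack X =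
        projStack (fun t : Fin n => b t k) X := by
      ext ω p
      simp only [Function.comp_apply, blockMap_apply]
      rfl
    rw [hcomp] at h
    simp only [Fintype.card_prod, Fintype.card_fin, Nat.cast_mul] at h
    exact h
  have htop : hbar P (stack X) = n * M * Real.log Real.pi - meanLogMix μ (blockForm ⊤) := by
    rw [hbar, ← hμdef, diffEntropy_conv_eq hμ, blockForm_top]
    simp only [Fintype.card_prod, Fintype.card_fin, Nat.cast_mul]
  have hchain := sum_mergeLeft_le (cost := cost) (C := C) (A := n * (2 * M * Real.log C))
    (g := fun S : Fin n → Submodule ℂ (Fin M → ℂ) => -meanLogMix μ (blockForm S))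
    (fun S V h => by
      have := hcost n μ hμ S V C hC h
      linarith)
    (by rw [meanLogMix_blockForm_bot, neg_zero]) (List.ofFn V) L
    (fun t => by rw [spans_eq_map b t]; exact hrounds t)
    (fun t j hj => by
      rw [spans_eq_map b t, ← leftover_eq_mergeLeft, ← fillSet_eq_mergeSet]
      -- An index below the infimum is not the index of an incomplete set.
      by_contra hne
      exact Nat.notMem_of_lt_sInf (hj.trans_le (hL t)) hne)
  -- Mixtures are at most 1, so what is left after L rounds contributes a nonnegative amount.
  have hrest : 0 ≤ ((mergeLeft (List.ofFn V) L).map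
      fun S => -meanLogMix μ (blockForm S)).sum := by
    refine List.sum_nonneg fun x hx => ?_
    obtain ⟨S, -, rfl⟩ := List.mem_map.1 hx
    have := meanLogMix_nonpos (μ := μ) (quadBound_blockForm S)
    linarith
  rw [List.map_ofFn, List.sum_ofFn, List.length_ofFn] at hchain
  simp only [Function.comp_apply] at hchain
  have hsum := Finset.sum_le_sum fun k (_ : k ∈ Finset.univ) => hproj k
  rw [Finset.sum_sub_distrib] at hsum
  have hrem : ∑ k, (n * l k * (Real.log (2 * (2 + 6 * C)) + 4 * Real.log 2) +
      n * M * (8 * C * C * Real.log 2)) = n * ∑ k, (l k * (Real.log (2 * (2 + 6 * C)) +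
        4 * Real.log 2) + M * (8 * C * C * Real.log 2)) := by
    rw [Finset.mul_sum]
    exact Finset.sum_congr rfl fun k _ => by ring
  rw [hrem] at hsum
  rw [htop, remainder, ge_iff_le]
  linarith

end EntropyBound

/-! ### Counting complete sets in general position -/

section Counting

variable {E : Type*} [AddCommGroup E] [Module ℂ E]

/-- The process completes exactly `m` sets. -/
def CompletesExactly : ℕ → List (Submodule ℂ E) → Prop
  | 0, Q => (mergeSet ⊥ Q).1 ≠ ⊤
  | m + 1, Q => (mergeSet ⊥ Q).1 = ⊤ ∧ CompletesExactly m (mergeSet ⊥ Q).2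

lemma mergeLeft_succ (Q : List (Submodule ℂ E)) (j : ℕ) :
    mergeLeft Q (j + 1) = mergeLeft (mergeSet ⊥ Q).2 j := by
  induction j with
  | zero => rfl
  | succ j ih => rw [mergeLeft, ih]; rfl

lemma CompletesExactly.numCompleteSets_eq {m : ℕ} {Q : List (Submodule ℂ E)}
    (h : CompletesExactly m Q) : numCompleteSets Q = m := by
  have key : (mergeSet ⊥ (mergeLeft Q m)).1 ≠ ⊤ ∧
      ∀ j < m, (mergeSet ⊥ (mergeLeft Q j)).1 = ⊤ := by
    induction m generalizing Q with
    | zero => exact ⟨h, fun j hj => absurd hj (Nat.not_lt_zero j)⟩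
    | succ m ih =>
      obtain ⟨h1, h2⟩ := ih h.2
      refine ⟨by rwa [mergeLeft_succ], fun j hj => ?_⟩
      cases j with
      | zero => exact h.1
      | succ j => rw [mergeLeft_succ]; exact h2 j (by omega)
  unfold numCompleteSets
  simp only [leftover_eq_mergeLeft, fillSet_eq_mergeSet]
  exact IsLeast.csInf_eq ⟨key.1, fun j hj => not_lt.1 fun hlt => hj (key.2 j hlt)⟩

open Classical in
/-- The nonzero members of a sequence of subspaces. -/
noncomputable def nonzeroPart (Q : List (Submodule ℂ E)) : List (Submodule ℂ E) :=
  Q.filter (· ≠ ⊥)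

lemma nonzeroPart_bot_cons (Q : List (Submodule ℂ E)) : nonzeroPart (⊥ :: Q) = nonzeroPart Q := by
  simp [nonzeroPart]

lemma nonzeroPart_cons (V : Submodule ℂ E) (Q : List (Submodule ℂ E)) :
    nonzeroPart (V :: Q) = nonzeroPart [V] ++ nonzeroPart Q := by
  rw [nonzeroPart, nonzeroPart, nonzeroPart, ← List.filter_append, List.singleton_append]

/-- Merging ⊥ does not change S and leaves ⊥ over, so zero subspaces affect neither completion nor
the nonzero rest. -/
lemma mergeSet_nonzeroPart (S : Submodule ℂ E) (Q : List (Submodule ℂ E)) :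
    (mergeSet S (nonzeroPart Q)).1 = (mergeSet S Q).1 ∧
      nonzeroPart (mergeSet S (nonzeroPart Q)).2 = nonzeroPart (mergeSet S Q).2 := by
  induction Q generalizing S with
  | nil => exact ⟨rfl, rfl⟩
  | cons V Q ih =>
    by_cases hV : V = ⊥
    · subst hV
      rw [nonzeroPart_bot_cons]
      simpa [mergeSet, nonzeroPart_bot_cons] using ih S
    · have h : nonzeroPart (V :: Q) = V :: nonzeroPart Q := by simp [nonzeroPart, hV]
      obtain ⟨h1, h2⟩ := ih (S ⊔ V)
      rw [h]
      refine ⟨h1, ?_⟩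
      simp only [mergeSet]
      rw [nonzeroPart_cons, h2, ← nonzeroPart_cons]

lemma CompletesExactly.congr {m : ℕ} {Q Q' : List (Submodule ℂ E)}
    (h : nonzeroPart Q = nonzeroPart Q') (hQ : CompletesExactly m Q) : CompletesExactly m Q' := by
  have h1 : (mergeSet ⊥ Q).1 = (mergeSet ⊥ Q').1 := by
    rw [← (mergeSet_nonzeroPart ⊥ Q).1, h, (mergeSet_nonzeroPart ⊥ Q').1]
  have h2 : nonzeroPart (mergeSet ⊥ Q).2 = nonzeroPart (mergeSet ⊥ Q').2 := by
    rw [← (mergeSet_nonzeroPart ⊥ Q).2, h, (mergeSet_nonzeroPart ⊥ Q').2]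
  induction m generalizing Q Q' with
  | zero => rw [CompletesExactly, ← h1]; exact hQ
  | succ m ih =>
    refine ⟨h1 ▸ hQ.1, ih h2 hQ.2 ?_ ?_⟩
    · rw [← (mergeSet_nonzeroPart ⊥ _).1, h2, (mergeSet_nonzeroPart ⊥ _).1]
    · rw [← (mergeSet_nonzeroPart ⊥ _).2, h2, (mergeSet_nonzeroPart ⊥ _).2]

/-- Serves to replace S :: V :: Q by (S ⊔ V) :: Q when S ⊓ V = ⊥. -/
lemma CompletesExactly.of_mergeSet {m : ℕ} {Q Q' : List (Submodule ℂ E)}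
    (h1 : (mergeSet ⊥ Q).1 = (mergeSet ⊥ Q').1)
    (h2 : nonzeroPart (mergeSet ⊥ Q).2 = nonzeroPart (mergeSet ⊥ Q').2)
    (hQ : CompletesExactly m Q) : CompletesExactly m Q' := by
  cases m with
  | zero => rw [CompletesExactly, ← h1]; exact hQ
  | succ m => exact ⟨h1 ▸ hQ.1, hQ.2.congr h2⟩

open Classical in
/-- The span of the current set after `V` is merged into `S`: if the set becomes complete, the next
one starts with the left-over part of `V`. -/
noncomputable def nextSpan (S V : Submodule ℂ E) : Submodule ℂ E :=
  if S ⊔ V = ⊤ then S ⊓ V else S ⊔ V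

/-- Each subspace is in general position with the span of the current set. -/
def GeneralPosition : Submodule ℂ E → List (Submodule ℂ E) → Prop
  | _, [] => True
  | S, V :: Q => min (Module.finrank ℂ E) (Module.finrank ℂ S + Module.finrank ℂ V) ≤
      Module.finrank ℂ ↥(S ⊔ V) ∧ GeneralPosition (nextSpan S V) Q

/-- The head S stands for the set under construction. If S ⊔ V is not the whole space, general
position forces S ⊓ V = ⊥ and no dimension is lost. If it is, the rest of Q passes through untouched
and S ⊓ V, at its head, opens the next set. -/
lemma GeneralPosition.completesExactly [FiniteDimensional ℂ E] (S : Submodule ℂ E) (hS : S ≠ ⊤)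
    (Q : List (Submodule ℂ E)) (hQ : GeneralPosition S Q) :
    CompletesExactly ((Module.finrank ℂ S + (Q.map fun V : Submodule ℂ E => Module.finrank ℂ V).sum) /
      Module.finrank ℂ E) (S :: Q) := by
  induction Q generalizing S with
  | nil =>
    have hlt := Submodule.finrank_lt hS
    simp only [List.map_nil, List.sum_nil, add_zero]
    rw [Nat.div_eq_of_lt hlt]
    simpa [CompletesExactly, mergeSet] using hS
  | cons V Q ih =>
    obtain ⟨h1, h2⟩ := hQ
    have hdim := Submodule.finrank_sup_add_finrank_inf_eq S V
    simp only [List.map_cons, List.sum_cons]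
    have hpos : 0 < Module.finrank ℂ E := (Nat.zero_le _).trans_lt (Submodule.finrank_lt hS)
    by_cases htop : S ⊔ V = ⊤
    · rw [nextSpan, if_pos htop] at h2
      have h3 := ih (S ⊓ V) (fun h => hS (top_le_iff.1 (h.symm.le.trans inf_le_left))) h2
      rw [htop, finrank_top] at hdim
      -- Completion uses up exactly dim E: dim (S ⊓ V) = dim S + dim V - dim E.
      have hcount : (Module.finrank ℂ S + (Module.finrank ℂ V +
          (Q.map fun V : Submodule ℂ E => Module.finrank ℂ V).sum)) / Module.finrank ℂ E =
          (Module.finrank ℂ ↥(S ⊓ V) + (Q.map fun V : Submodule ℂ E => Module.finrank ℂ V).sum) /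
            Module.finrank ℂ E + 1 := by
        rw [← Nat.add_div_right _ hpos]
        congr 1
        omega
      rw [hcount]
      refine ⟨?_, ?_⟩
      · simp [mergeSet, htop, mergeSet_top]
      · refine h3.congr ?_
        simp [mergeSet, htop, mergeSet_top, nonzeroPart_bot_cons]
    · rw [nextSpan, if_neg htop] at h2
      have h3 := ih (S ⊔ V) htop h2
      have hlt := Submodule.finrank_lt htop
      have hinf : S ⊓ V = ⊥ := by
        rw [← Submodule.finrank_eq_zero (R := ℂ)]
        omega
      have hsup : Module.finrank ℂ ↥(S ⊔ V) = Module.finrank ℂ S + Module.finrank ℂ V := by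
        rw [hinf, finrank_bot] at hdim
        omega
      rw [hsup, add_assoc] at h3
      refine h3.of_mergeSet ?_ ?_
      · simp [mergeSet]
      · simp [mergeSet, hinf, nonzeroPart_bot_cons]

end Counting

/-! ### Generic subspaces are in general position -/

section GenericPosition

variable {M : ℕ}

lemma span_range_sumElim {κ κ' : Type*} (a : κ → Fin M → ℂ) (b : κ' → Fin M → ℂ) :
    Submodule.span ℂ (Set.range (Sum.elim a b)) =
      Submodule.span ℂ (Set.range a) ⊔ Submodule.span ℂ (Set.range b) := by
  rw [Set.Sum.elim_range, Submodule.span_union]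

/-- The rank is lower semicontinuous: it is at least n exactly when some n coefficient vectors give
independent combinations, which is a union of open conditions. -/
lemma measurable_finrank_span {κ : Type*} [Fintype κ] :
    Measurable fun v : κ → Fin M → ℂ => Module.finrank ℂ (Submodule.span ℂ (Set.range v)) := by
  refine measurable_of_Ici fun n => IsOpen.measurableSet ?_
  have heq : (fun v : κ → Fin M → ℂ => Module.finrank ℂ (Submodule.span ℂ (Set.range v))) ⁻¹'
      Set.Ici n = ⋃ s ∈ {s : Finset (κ → ℂ) | s.card = n},
        {v | LinearIndependent ℂ fun x : (s : Set (κ → ℂ)) => ∑ i, x.1 i • v i} := by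
    ext v
    have hr := Fintype.range_linearCombination ℂ v
    have h := LinearMap.le_rank_iff_exists_linearIndependent_finset
      (f := Fintype.linearCombination ℂ v) (n := n)
    rw [LinearMap.rank, hr, ← Module.finrank_eq_rank, Nat.cast_le] at h
    simp only [Set.mem_preimage, Set.mem_Ici, h, Set.mem_iUnion, Set.mem_ofPred_eq, exists_prop]
    rfl
  rw [heq]
  refine isOpen_biUnion fun s _ => ?_
  have hc : Continuous fun (v : κ → Fin M → ℂ) (x : (s : Set (κ → ℂ))) => ∑ i, x.1 i • v i := by
    fun_prop
  exact isOpen_setOfPred_linearIndependent.preimage hc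

lemma measurable_finrank_sup {Ω κ κ' : Type*} [MeasurableSpace Ω] [Fintype κ] [Fintype κ']
    {a : Ω → κ → Fin M → ℂ} {b : Ω → κ' → Fin M → ℂ} (ha : Measurable a) (hb : Measurable b) :
    Measurable fun ω => Module.finrank ℂ ↥(Submodule.span ℂ (Set.range (a ω)) ⊔
      Submodule.span ℂ (Set.range (b ω))) := by
  have h : Measurable fun ω => (Sum.elim (a ω) (b ω) : κ ⊕ κ' → Fin M → ℂ) := by
    refine measurable_pi_lambda _ fun k => ?_
    cases k with
    | inl k => exact (measurable_pi_apply k).comp ha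
    | inr k => exact (measurable_pi_apply k).comp hb
  have heq : (fun ω => Module.finrank ℂ ↥(Submodule.span ℂ (Set.range (a ω)) ⊔
      Submodule.span ℂ (Set.range (b ω)))) = fun ω => Module.finrank ℂ
        (Submodule.span ℂ (Set.range (Sum.elim (a ω) (b ω)))) := by
    funext ω
    rw [span_range_sumElim]
  rw [heq]
  exact measurable_finrank_span.comp h

lemma ae_notMem_submodule {S : Submodule ℂ (Fin M → ℂ)} (hS : S ≠ ⊤) :
    ∀ᵐ v : Fin M → ℂ, v ∉ S := by
  have h := Measure.addHaar_submodule (volume : Measure (Fin M → ℂ)) (S.restrictScalars ℝ)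
    (by rwa [Ne, Submodule.restrictScalars_eq_top_iff])
  exact measure_eq_zero_iff_ae_notMem.1 h

/-- Fubini for the first coordinate against the others. -/
lemma ae_pi_succ {l : ℕ} {F : Fin (l + 1) → Type*} [∀ i, MeasureSpace (F i)]
    [∀ i, SigmaFinite (volume : Measure (F i))] {p : F 0 × (∀ i : Fin l, F i.succ) → Prop}
    (hp : MeasurableSet {x | p x}) (h : ∀ᵐ v : F 0, ∀ᵐ w : ∀ i : Fin l, F i.succ, p (v, w)) :
    ∀ᵐ b : ∀ i, F i, p (b 0, fun i => b i.succ) := by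
  have : SigmaFinite (volume : Measure (∀ i : Fin l, F i.succ)) := Measure.pi.sigmaFinite _
  have hprod : ∀ᵐ x : F 0 × (∀ i : Fin l, F i.succ), p x := (Measure.ae_prod_iff_ae_ae hp).2 h
  exact (volume_preserving_piFinSuccAbove F 0).quasiMeasurePreserving.ae hprod

/-- Almost every family of `l` vectors is in general position with a given subspace. -/
lemma ae_min_le_finrank_sup_span (l : ℕ) {κ : Type} [Fintype κ] (a : κ → Fin M → ℂ) :
    ∀ᵐ b : Fin l → Fin M → ℂ,
      min M (Module.finrank ℂ (Submodule.span ℂ (Set.range a)) + l) ≤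
        Module.finrank ℂ ↥(Submodule.span ℂ (Set.range a) ⊔ Submodule.span ℂ (Set.range b)) := by
  induction l generalizing κ with
  | zero =>
    refine ae_of_all _ fun b => (min_le_right _ _).trans ?_
    exact Submodule.finrank_mono le_sup_left
  | succ l ih =>
    set S := Submodule.span ℂ (Set.range a) with hS
    have key := ae_pi_succ (l := l) (F := fun _ => Fin M → ℂ)
      (p := fun x => min M (Module.finrank ℂ S + (l + 1)) ≤
        Module.finrank ℂ ↥(Submodule.span ℂ (Set.range (Sum.elim a fun _ : Unit => x.1)) ⊔
          Submodule.span ℂ (Set.range x.2))) ?_ ?_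
    · filter_upwards [key] with b hb
      have hspan : Submodule.span ℂ (Set.range b) =
          Submodule.span ℂ {b 0} ⊔ Submodule.span ℂ (Set.range fun i : Fin l => b i.succ) := by
        rw [← Submodule.span_union, Set.singleton_union, ← Fin.range_cons]
        exact congrArg _ (congrArg _ (Fin.cons_self_tail b).symm)
      rwa [span_range_sumElim, Set.range_const, sup_assoc, ← hspan] at hb
    · refine measurableSet_le measurable_const (measurable_finrank_sup ?_ measurable_snd)
      refine measurable_pi_lambda _ fun k => ?_
      cases k with
      | inl k => exact measurable_const
      | inr k => exact measurable_fst
    · have hv : ∀ᵐ v : Fin M → ℂ, min M (Module.finrank ℂ S + 1) ≤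
          Module.finrank ℂ (Submodule.span ℂ (Set.range (Sum.elim a fun _ : Unit => v))) := by
        by_cases htop : S = ⊤
        · refine ae_of_all _ fun v => (min_le_left _ _).trans ?_
          rw [span_range_sumElim, ← hS, htop, top_sup_eq, finrank_top, Module.finrank_fin_fun]
        · filter_upwards [ae_notMem_submodule htop] with v hv
          refine (min_le_right _ _).trans (Submodule.finrank_lt_finrank_of_lt ?_)
          rw [span_range_sumElim, ← hS, Set.range_const]
          refine lt_of_le_of_ne le_sup_left fun h => hv ?_
          rw [h]
          exact (le_sup_right : _ ≤ S ⊔ _) (Submodule.mem_span_singleton_self v)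
      filter_upwards [hv] with v hv
      filter_upwards [ih (Sum.elim a fun _ : Unit => v)] with w hw
      refine le_trans ?_ hw
      omega

lemma ae_linearIndependent {l : ℕ} (hl : l ≤ M) :
    ∀ᵐ b : Fin l → Fin M → ℂ, LinearIndependent ℂ b := by
  filter_upwards [ae_min_le_finrank_sup_span l (fun i : Fin 0 => i.elim0 : Fin 0 → Fin M → ℂ)]
    with b hb
  rw [linearIndependent_iff_card_le_finrank_span, Fintype.card_fin]
  rwa [Set.range_eq_empty, Submodule.span_empty, bot_sup_eq, finrank_bot, zero_add,
    min_eq_right hl] at hb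

open scoped Matrix ComplexOrder

/-- The Gram-type matrix whose range is the span of the vectors `v`. -/
noncomputable def spanMatrix {κ : Type*} [Fintype κ] (v : κ → Fin M → ℂ) :
    Matrix (Fin M) (Fin M) ℂ :=
  (Matrix.of v)ᵀ * ((Matrix.of v)ᵀ)ᴴ

/-- A Aᴴ has its range inside that of A and the same rank. Its size does not depend on the number of
vectors, so such matrices can be added. -/
lemma range_spanMatrix {κ : Type*} [Fintype κ] (v : κ → Fin M → ℂ) :
    LinearMap.range (spanMatrix v).mulVecLin = Submodule.span ℂ (Set.range v) := by
  have h1 : LinearMap.range ((Matrix.of v)ᵀ).mulVecLin = Submodule.span ℂ (Set.range v) := by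
    rw [Matrix.range_mulVecLin]; rfl
  rw [← h1]
  refine Submodule.eq_of_le_of_finrank_eq ?_ (Matrix.rank_self_mul_conjTranspose _)
  rw [spanMatrix, Matrix.mulVecLin_mul]
  exact LinearMap.range_comp_le_range _ _

lemma continuous_spanMatrix {κ : Type*} [Fintype κ] :
    Continuous (spanMatrix : (κ → Fin M → ℂ) → Matrix (Fin M) (Fin M) ℂ) := by
  have h : Continuous fun v : κ → Fin M → ℂ => (Matrix.of v)ᵀ :=
    continuous_matrix fun i j => by simpa using by fun_prop
  exact h.matrix_mul h.matrix_conjTranspose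

/-- The matrix of two families put together is the sum of their matrices. -/
lemma range_add_spanMatrix {κ κ' : Type*} [Fintype κ] [Fintype κ'] (a : κ → Fin M → ℂ)
    (b : κ' → Fin M → ℂ) : LinearMap.range (spanMatrix a + spanMatrix b).mulVecLin =
      Submodule.span ℂ (Set.range a) ⊔ Submodule.span ℂ (Set.range b) := by
  rw [← span_range_sumElim, ← range_spanMatrix]
  congr 2
  ext i j
  simp [spanMatrix, Matrix.mul_apply]

/-- The range of the parallel sum of two matrices is the intersection of the ranges. -/
lemma range_mul_inv_mul {A B : Matrix (Fin M) (Fin M) ℂ} (h : IsUnit (A + B).det) :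
    LinearMap.range (A * (A + B)⁻¹ * B).mulVecLin =
      LinearMap.range A.mulVecLin ⊓ LinearMap.range B.mulVecLin := by
  -- Both sides equal B - B (A + B)⁻¹ B.
  have hcomm : A * (A + B)⁻¹ * B = B * (A + B)⁻¹ * A := by
    have h1 : (A + B) * (A + B)⁻¹ * B = B := by rw [Matrix.mul_nonsing_inv _ h, one_mul]
    have h2 : B * (A + B)⁻¹ * (A + B) = B := by
      rw [mul_assoc, Matrix.nonsing_inv_mul _ h, mul_one]
    rw [add_mul, add_mul] at h1
    rw [mul_add] at h2
    exact add_right_cancel (h1.trans h2.symm)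
  refine le_antisymm (le_inf ?_ ?_) ?_
  · rw [mul_assoc, Matrix.mulVecLin_mul]
    exact LinearMap.range_comp_le_range _ _
  · rw [hcomm, mul_assoc, Matrix.mulVecLin_mul]
    exact LinearMap.range_comp_le_range _ _
  · rintro x ⟨⟨u, hu⟩, ⟨v, hv⟩⟩
    rw [Matrix.mulVecLin_apply] at hu hv
    -- If x = A u = B v, the images of u and v are B (A + B)⁻¹ x and A (A + B)⁻¹ x, which add up to
    -- x.
    have h1 : (A * (A + B)⁻¹ * B) *ᵥ u = B *ᵥ ((A + B)⁻¹ *ᵥ x) := by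
      rw [hcomm, ← Matrix.mulVec_mulVec, hu, ← Matrix.mulVec_mulVec]
    have h2 : (A * (A + B)⁻¹ * B) *ᵥ v = A *ᵥ ((A + B)⁻¹ *ᵥ x) := by
      rw [← Matrix.mulVec_mulVec, hv, ← Matrix.mulVec_mulVec]
    refine ⟨u + v, ?_⟩
    rw [Matrix.mulVecLin_apply, Matrix.mulVec_add, h1, h2, ← Matrix.add_mulVec, add_comm B A,
      Matrix.mulVec_mulVec, Matrix.mul_nonsing_inv _ h, Matrix.one_mulVec]

open Classical in
/-- Vectors that span `nextSpan (span a) (span b)`, as a measurable function of `a` and `b`. -/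
noncomputable def nextVectors {l : ℕ} (a : Fin M → Fin M → ℂ) (b : Fin l → Fin M → ℂ) :
    Fin M → Fin M → ℂ := fun j i =>
  if (spanMatrix a + spanMatrix b).det = 0 then (spanMatrix a + spanMatrix b) i j
  else (spanMatrix a * (spanMatrix a + spanMatrix b)⁻¹ * spanMatrix b) i j

lemma span_range_nextVectors {l : ℕ} (a : Fin M → Fin M → ℂ) (b : Fin l → Fin M → ℂ) :
    Submodule.span ℂ (Set.range (nextVectors a b)) =
      nextSpan (Submodule.span ℂ (Set.range a)) (Submodule.span ℂ (Set.range b)) := by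
  set G := spanMatrix a + spanMatrix b with hG
  have hiff : Submodule.span ℂ (Set.range a) ⊔ Submodule.span ℂ (Set.range b) = ⊤ ↔
      IsUnit G.det := by
    rw [← range_add_spanMatrix, ← hG, LinearMap.range_eq_top, ← Matrix.isUnit_iff_isUnit_det,
      ← Matrix.mulVec_surjective_iff_isUnit]
    rfl
  by_cases h : G.det = 0
  · have h1 : nextVectors a b = G.col := by
      ext j i; simp only [nextVectors, ← hG, h, if_true]; rfl
    have h2 : ¬ (Submodule.span ℂ (Set.range a) ⊔ Submodule.span ℂ (Set.range b) = ⊤) := by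
      rw [hiff, h]; simp
    rw [h1, ← Matrix.range_mulVecLin, range_add_spanMatrix, nextSpan, if_neg h2]
  · have h1 : nextVectors a b = (spanMatrix a * G⁻¹ * spanMatrix b).col := by
      ext j i; simp [nextVectors, ← hG, h]
    rw [h1, ← Matrix.range_mulVecLin, range_mul_inv_mul (isUnit_iff_ne_zero.2 h),
      range_spanMatrix, range_spanMatrix, nextSpan, if_pos (hiff.2 (isUnit_iff_ne_zero.2 h))]

lemma measurable_nextVectors {l : ℕ} :
    Measurable fun p : (Fin M → Fin M → ℂ) × (Fin l → Fin M → ℂ) => nextVectors p.1 p.2 := by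
  have ha : Continuous fun p : (Fin M → Fin M → ℂ) × (Fin l → Fin M → ℂ) => spanMatrix p.1 :=
    continuous_spanMatrix.comp continuous_fst
  have hb : Continuous fun p : (Fin M → Fin M → ℂ) × (Fin l → Fin M → ℂ) => spanMatrix p.2 :=
    continuous_spanMatrix.comp continuous_snd
  have hG := ha.add hb
  have hdet := hG.matrix_det.measurable
  refine measurable_pi_lambda _ fun j => measurable_pi_lambda _ fun i => ?_
  refine Measurable.ite (hdet (measurableSet_singleton 0)) (hG.matrix_elem i j).measurable ?_
  -- Written through the adjugate, the inverse is continuous in the entries up to the measurable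
  -- factor det⁻¹.
  have hentry : ∀ p : (Fin M → Fin M → ℂ) × (Fin l → Fin M → ℂ),
      (spanMatrix p.1 * (spanMatrix p.1 + spanMatrix p.2)⁻¹ * spanMatrix p.2) i j =
      (spanMatrix p.1 + spanMatrix p.2).det⁻¹ *
        (spanMatrix p.1 * (spanMatrix p.1 + spanMatrix p.2).adjugate * spanMatrix p.2) i j := by
    intro p
    rw [Matrix.inv_def, Ring.inverse_eq_inv', Matrix.mul_smul, Matrix.smul_mul, Matrix.smul_apply,
      smul_eq_mul]
  simp_rw [hentry]
  exact hdet.inv.mul (((ha.matrix_mul hG.matrix_adjugate).matrix_mul hb).matrix_elem i j).measurable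

lemma spans_succ {K : ℕ} {l : Fin (K + 1) → ℕ} (b : ∀ k, Fin (l k) → Fin M → ℂ) :
    spans b = Submodule.span ℂ (Set.range (b 0)) :: spans fun k : Fin K => b k.succ := by
  rw [spans, List.ofFn_succ]; rfl

/-- The span of the current set is always carried by M vectors; `nextVectors` updates them
measurably, so the induction hypothesis is pulled back along a measurable map. -/
lemma measurableSet_generalPosition {K : ℕ} (l : Fin K → ℕ) :
    MeasurableSet {p : (Fin M → Fin M → ℂ) × (∀ k, Fin (l k) → Fin M → ℂ) |
      GeneralPosition (Submodule.span ℂ (Set.range p.1)) (spans p.2)} := by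
  induction K with
  | zero => simp [spans, GeneralPosition]
  | succ K ih =>
    simp only [spans_succ, GeneralPosition, ← span_range_nextVectors]
    have h0 : Measurable fun p : (Fin M → Fin M → ℂ) × (∀ k, Fin (l k) → Fin M → ℂ) => p.2 0 :=
      (measurable_pi_apply 0).comp measurable_snd
    refine MeasurableSet.inter (measurableSet_le ?_ (measurable_finrank_sup measurable_fst h0)) ?_
    · exact measurable_const.min ((measurable_finrank_span.comp measurable_fst).add
        (measurable_finrank_span.comp h0))
    · have hm : Measurable fun p : (Fin M → Fin M → ℂ) × (∀ k, Fin (l k) → Fin M → ℂ) =>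
          (nextVectors p.1 (p.2 0), fun k : Fin K => p.2 k.succ) :=
        (measurable_nextVectors.comp (measurable_fst.prodMk h0)).prodMk
          (measurable_pi_lambda _ fun k => (measurable_pi_apply k.succ).comp measurable_snd)
      exact hm (ih fun k => l k.succ)

/-- Almost all subspaces are in general position. -/
lemma ae_generalPosition {K : ℕ} (l : Fin K → ℕ) (hl : ∀ k, l k ≤ M) (a : Fin M → Fin M → ℂ) :
    ∀ᵐ b : ∀ k, Fin (l k) → Fin M → ℂ,
      GeneralPosition (Submodule.span ℂ (Set.range a)) (spans b) := by
  induction K generalizing a with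
  | zero => exact ae_of_all _ fun b => by simp [spans, GeneralPosition]
  | succ K ih =>
    have key := ae_pi_succ (F := fun k => Fin (l k) → Fin M → ℂ)
      (p := fun x => GeneralPosition (Submodule.span ℂ (Set.range a))
        (Submodule.span ℂ (Set.range x.1) :: spans x.2)) ?_ ?_
    · filter_upwards [key] with b hb
      rwa [spans_succ]
    · have hm : Measurable fun x : (Fin (l 0) → Fin M → ℂ) ×
          (∀ k : Fin K, Fin (l k.succ) → Fin M → ℂ) => (a, (Fin.cons x.1 x.2 :
            ∀ k, Fin (l k) → Fin M → ℂ)) := by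
        refine measurable_const.prodMk (measurable_pi_lambda _ fun k => ?_)
        refine Fin.cases ?_ (fun k => ?_) k
        · exact measurable_fst
        · exact (measurable_pi_apply k).comp measurable_snd
      have h := hm (measurableSet_generalPosition l)
      simpa only [Set.preimage_ofPred_eq, spans_succ, Fin.cons_zero, Fin.cons_succ] using h
    · filter_upwards [ae_min_le_finrank_sup_span (l 0) a, ae_linearIndependent (hl 0)] with v h1 h2
      -- For a fixed good first subspace, the later ones only have to be generic relative to the
      -- updated span.
      filter_upwards [ih (fun k => l k.succ) (fun k => hl k.succ) (nextVectors a v)] with w hw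
      rw [span_range_nextVectors] at hw
      refine ⟨?_, hw⟩
      rwa [finrank_span_eq_card h2, Module.finrank_fin_fun, Fintype.card_fin]

end GenericPosition

/-! ### The generic count, and the theorem -/

lemma ae_numCompleteSets_eq {M K : ℕ} (hM : 0 < M) (l : Fin K → ℕ) (hl : ∀ k, l k ≤ M) :
    ∀ᵐ b : ∀ k, Fin (l k) → Fin M → ℂ,
      (∀ k, LinearIndependent ℂ (b k)) ∧ numCompleteSets (spans b) = (∑ k, l k) / M := by
  have hind : ∀ᵐ b : ∀ k, Fin (l k) → Fin M → ℂ, ∀ k, LinearIndependent ℂ (b k) :=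
    ae_all_iff.2 fun k =>
      (Measure.quasiMeasurePreserving_eval (fun k => (volume : Measure (Fin (l k) → Fin M → ℂ))) k).ae (ae_linearIndependent (hl k))
  -- The process starts from ⊥, represented by M zero vectors; the extra ⊥ at the head of the
  -- sequence is discarded below.
  filter_upwards [hind, ae_generalPosition l hl fun _ _ => 0] with b h1 h2
  refine ⟨h1, ?_⟩
  have hbot : Submodule.span ℂ (Set.range fun _ : Fin M => (fun _ => 0 : Fin M → ℂ)) = ⊥ :=
    Submodule.span_eq_bot.2 (by rintro _ ⟨i, rfl⟩; rfl)
  have : Nonempty (Fin M) := ⟨⟨0, hM⟩⟩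
  rw [hbot] at h2
  have h3 := ((h2.completesExactly ⊥ bot_ne_top).congr (nonzeroPart_bot_cons _)).numCompleteSets_eq
  rw [h3, finrank_bot, zero_add, Module.finrank_fin_fun, spans, List.map_ofFn, List.sum_ofFn]
  congr 1
  refine Finset.sum_congr rfl fun k _ => ?_
  simp only [Function.comp_apply]
  rw [finrank_span_eq_card (h1 k), Fintype.card_fin]

theorem lemma3 {M K : ℕ} (hM : 0 < M) (l : Fin K → ℕ) :
    -- the entropy bound, for subspaces with bases `b t k`
    (∀ (b : ℕ → ∀ k, Fin (l k) → Fin M → ℂ), (∀ t k, LinearIndependent ℂ (b t k)) →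
      ∀ (Lsum : ℕ), (∀ t, Lsum ≤ numCompleteSets (spans (b t))) →
        -- for every block length
        (∀ n : ℕ, ∃ f : ℝ → ℝ, f =o[atTop] Real.log ∧ NoisyEntropyBound.{u} b Lsum n f) ∧
        -- uniformly in the block length, if the bases take finitely many values over time
        ((Set.range b).Finite →
          ∃ f : ℝ → ℝ, f =o[atTop] Real.log ∧ ∀ n : ℕ, NoisyEntropyBound.{u} b Lsum n f)) ∧
    -- the number of complete sets for generic subspaces
    ((∀ k, l k ≤ M) →
      ∀ᵐ b : ∀ k, Fin (l k) → Fin M → ℂ,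
        (∀ k, LinearIndependent ℂ (b k)) ∧ numCompleteSets (spans b) = (∑ k, l k) / M) := by
  refine ⟨fun b _ Lsum hb => ?_, ae_numCompleteSets_eq hM l⟩
  obtain ⟨R, hR⟩ := exists_noisyEntropyBound_remainder.{u} M l Lsum
  constructor
  · intro n
    -- Only the bases at times t < n enter, so a finite bound exists. The remainder is constant in
    -- ρ, hence o(log ρ).
    obtain ⟨C, hC⟩ := ((Set.finite_Iio n).image fun t => R (b t)).bddAbove
    exact ⟨_, Real.isLittleO_const_log_atTop, hR b hb n (max 1 C) (le_max_left _ _) fun t ht =>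
      (hC ⟨t, ht, rfl⟩).trans (le_max_right _ _)⟩
  · intro hfin
    obtain ⟨C, hC⟩ := (hfin.image R).bddAbove
    exact ⟨_, Real.isLittleO_const_log_atTop, fun n => hR b hb n (max 1 C) (le_max_left _ _)
      fun t _ => (hC ⟨b t, ⟨t, rfl⟩, rfl⟩).trans (le_max_right _ _)⟩
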